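/- **Labels.** Let $\mathcal N$ be a set of atomic principals with static delegations (each atomic principal may delegate to arbitrary formulas over $\mathcal N$). Let $\mathbb A$ be the bounded distributive lattice of formulas $a ::= n \mid \top \mid \bot \mid a\wedge a \mid a\vee a$ modulo mutual acts-for, where $\succcurlyeq$ ("acts for") is generated by the lattice rules, distributivity and the delegations ($\varphi\succcurlyeq n$ if $n$ delegates to $\varphi$); $a\wedge b$ is the least authority acting for both. A label (principal) is $\ell=p^{\to}\wedge q^{\leftarrow}$ with $p,q\in\mathbb A$ (confidentiality, integrity); $\mathcal L$ is the set of labels, and $\succcurlyeq,\wedge,\vee$ act componentwise. Projections: $\ell^{\to}=p^{\to}\wedge\bot^{\leftarrow}$, $\ell^{\leftarrow}=\bot^{\to}\wedge q^{\leftarrow}$. Flow order: $p^{\to}\wedge q^{\leftarrow}\sqsubseteq p'^{\to}\wedge q'^{\leftarrow}$ iff $p'\succcurlyeq p$ and $q\succcurlyeq q'$, with join $(p\wedge p')^{\to}\wedge(q\vee q')^{\leftarrow}$. View and voice: $\Delta(p^{\to}\wedge q^{\leftarrow})=q^{\to}$, $\nabla(p^{\to}\wedge q^{\leftarrow})=p^{\leftarrow}$.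 **Calculus (NMIFC).** Types: $\tau::=\mathsf{unit}\mid X\mid\tau+\tau\mid\tau\times\tau\mid\tau\xrightarrow{pc}\tau\mid\forall X[pc].\tau\mid \ell\ \mathsf{says}\ \tau$. Values: $v::=()\mid \mathsf{inj}_i v\mid\langle v,v\rangle\mid\bar\eta_\ell v\mid\lambda(x{:}\tau)[pc].e\mid\Lambda X[pc].e$. Expressions: $e::=x\mid v\mid e\,e\mid e\,\tau\mid\langle e,e\rangle\mid\eta_\ell e\mid\mathsf{proj}_i e\mid\mathsf{inj}_i e\mid\mathsf{bind}\ x=e\ \mathsf{in}\ e\mid\mathsf{case}\ e\ \mathsf{of}\ \mathsf{inj}_1x.e\mid\mathsf{inj}_2x.e\mid\mathsf{decl}\ e\ \mathsf{to}\ \ell\mid\mathsf{endorse}\ e\ \mathsf{to}\ \ell$. Terms are in Church style: $\eta_\ell,\bar\eta_\ell$ carry the type of their content and $\mathsf{inj}_i$ carries the sum type, so a term has at most one type in a given context. Evaluation is call by value, left to right (also under $\eta_\ell$, $\mathsf{inj}_i$, $\mathsf{proj}_i$, in pairs, type applications, scrutinees of $\mathsf{bind}$ and $\mathsf{case}$,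 and arguments of $\mathsf{decl}$ and $\mathsf{endorse}$), on configurations $\langle e,t\rangle$ whose trace $t$ is a finite sequence of events; every step appends one event. The $\beta$-steps for functions, type abstractions, projections, $\mathsf{case}$ and $\mathsf{bind}\ x=\bar\eta_\ell v\ \mathsf{in}\ e\to e[x\mapsto v]$ append the null event $\bullet$; $\eta_\ell v\to\bar\eta_\ell v$ appends $\bar\eta_\ell v$; $\mathsf{decl}\ \bar\eta_{\ell'}v\ \mathsf{to}\ \ell\to\bar\eta_\ell v$ appends $\downarrow^{\to}_{\ell',\ell}v$, and $\mathsf{endorse}\ \bar\eta_{\ell'}v\ \mathsf{to}\ \ell\to\bar\eta_\ell v$ appends $\downarrow^{\leftarrow}_{\ell',\ell}v$. A type protects a label, $\ell\vdash\tau$, if $\tau=\mathsf{unit}$, or $\tau=\ell'\ \mathsf{says}\ \tau'$ with $\ell\sqsubseteq\ell'$, or $\tau=\tau_1\times\tau_2$ with $\ell\vdash\tau_1$, $\ell\vdash\tau_2$. The judgement $\Gamma;pc\vdash e:\tau$ has the usual rules for variables, unit, pairs, projections and injections; bodies of $\lambda,\Lambda$ are typed at the annotated $pc'$; applying a function or type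 abstraction annotated $pc'$ requires $pc\sqsubseteq pc'$ (and a well-formed type argument); $\mathsf{case}$ with result type $\tau$ requires $pc\vdash\tau$; and - $\Gamma;pc\vdash\eta_\ell e:\ell\ \mathsf{says}\ \tau$ if $\Gamma;pc\vdash e:\tau$ and $pc\sqsubseteq\ell$; $\Gamma;pc\vdash\bar\eta_\ell v:\ell\ \mathsf{says}\ \tau$ if $\Gamma;pc\vdash v:\tau$; - $\Gamma;pc\vdash\mathsf{bind}\ x=e\ \mathsf{in}\ e':\tau$ if $\Gamma;pc\vdash e:\ell\ \mathsf{says}\ \tau'$, $\ell\vdash\tau$ and $\Gamma,x{:}\tau';pc\sqcup\ell\vdash e':\tau$; - for $\Gamma;pc\vdash e:\ell'\ \mathsf{says}\ \tau$ and $pc\sqsubseteq\ell$: $\mathsf{decl}\ e\ \mathsf{to}\ \ell$ has type $\ell\ \mathsf{says}\ \tau$ if $\ell'^{\leftarrow}=\ell^{\leftarrow}$ and $\ell'^{\to}\sqsubseteq\ell^{\to}\sqcup\Delta((\ell'\sqcup pc)^{\leftarrow})$; $\mathsf{endorse}\ e\ \mathsf{to}\ \ell$ has it if $\ell'^{\to}=\ell^{\to}$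 and $\ell'^{\leftarrow}\sqsubseteq\ell^{\leftarrow}\sqcup\nabla((\ell'\sqcup pc)^{\to})$. **Attackers.** For $\mathcal A\subseteq\mathcal L$ put $\mathcal A^{\pi}=\{p\mid\exists q\in\mathcal L,\ p^{\pi}\wedge q^{\pi'}\in\mathcal A\}$, $\pi'$ being the aspect opposite to $\pi$. $\mathcal A$ is an attacker if it is closed under $\succcurlyeq$ ($p\in\mathcal A$, $p\succcurlyeq q$ imply $q\in\mathcal A$) and, for both aspects: $a_1,a_2\in\mathcal A^\pi\Rightarrow a_1\wedge a_2\in\mathcal A^\pi$; $a\in\mathcal A^\pi\Rightarrow a\vee b\in\mathcal A^\pi$; $b_1,b_2\notin\mathcal A^\pi\Rightarrow b_1\vee b_2\notin\mathcal A^\pi$; $b\notin\mathcal A^\pi\Rightarrow a\wedge b\notin\mathcal A^\pi$; and $a\in\mathcal A\Rightarrow\nabla(a^{\to})\wedge\Delta(a^{\leftarrow})\in\mathcal A$. (Example: all principals for which $n_1\wedge\dots\wedge n_k$ acts, $k\ge1$, $n_i$ atomic.) Put $\mathcal U=\{\ell\mid\ell^{\leftarrow}\in\mathcal A\}$ (untrusted),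 $\mathcal S=\{\ell\mid\ell^{\to}\notin\mathcal A\}$ (secret), $\mathcal T=\mathcal L\setminus\mathcal U$, $\mathcal P=\mathcal L\setminus\mathcal S$. A type $\tau$ is high for $\mathcal H$ if $h\vdash\tau$ for some $h\in\mathcal H$. **Low equivalence.** For $W\subseteq\mathcal L$, $\approx_W$ on terms is the smallest congruence with $\bar\eta_\ell v\approx_W\bullet_{\ell\,\mathsf{says}\,\tau}$ whenever $\ell\notin W$, where $\tau$ is the content type carried by $\bar\eta_\ell v$ and $\bullet_{\ell\,\mathsf{says}\,\tau}$ is a formal mark for an invisible value of that type. On events it is the smallest congruence containing $\approx_W$ on the values shown, together with $\bar\eta_\ell v\approx_W\bullet$ and $\downarrow^\pi_{\ell',\ell}v\approx_W\bullet$ for $\ell\notin W$. On traces it is the smallest congruence for concatenation that contains $\approx_W$ on events and satisfies $t;\bullet\approx_W t\approx_W\bullet;t$. **Relevant secrets.** Let $\Gamma,x{:}\tau_x,y{:}\tau_y;pc\vdash e:\tau$. Write $e(v,w)\Downarrow t$ if $\langle e[x\mapsto v][y\mapsto w],\,v;w\rangle\to^*\langle u,t\rangle$ for a value $u$. A value $v_1$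 with $\Gamma;pc\vdash v_1:\tau_x$ is *irrelevant* if there are values $v_2,w_1,w_2$ with $\Gamma;pc\vdash v_2:\tau_x$, $\Gamma;pc\vdash w_j:\tau_y$, traces $t^{ij}$ with $e(v_i,w_j)\Downarrow t^{ij}$, and positions $n_{ij}$ in them such that the $n_{ij}$-th event of $t^{ij}$ is not $\approx_{\mathcal T\cap\mathcal P}\bullet$ and, for the prefixes $p^{ij}$ consisting of the first $n_{ij}$ events, all four $p^{ij}$ are $\approx_{\mathcal T\cap\mathcal P}$-equivalent, $p^{11}\approx_{\mathcal T}p^{12}$ and $p^{21}\not\approx_{\mathcal T}p^{22}$. Otherwise it is *relevant*. **Theorem (Transparent endorsement).** Let $\Gamma,x{:}\tau_x,y{:}\tau_y;pc\vdash e:\tau$ and let $e$ contain no $\mathsf{decl}$ expression. Then for every attacker $\mathcal A$ such that $\tau_x$ is high for $\mathcal S$ and $\tau_y$ is high for $\mathcal U$, for all values $v_1,v_2$ of type $\tau_x$ and all values $w_1,w_2$ of type $\tau_y$ that contain no $\mathsf{decl}$ expression (all typed under $\Gamma;pc$), and for all traces with $e(v_i,w_j)\Downarrow t^{ij}$ $(i,j\in\{1,2\})$: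 $$\bigl(v_1\text{ is relevant and }t^{11}\approx_{\mathcal T}t^{12}\bigr)\ \Longrightarrow\ t^{21}\approx_{\mathcal T}t^{22}.$$ -/

import Mathlib

namespace NMIFC

universe u

/-! ## Principals and labels -/

/-- The two security aspects: confidentiality `→` and integrity `←`. -/
inductive Aspect where
  | conf
  | integ

def Aspect.opp : Aspect → Aspect
  | .conf => .integ
  | .integ => .conf

/-- Formulas over the atomic principals `N`. -/
inductive Form (N : Type u) where
  | atom (n : N)
  | top
  | bot
  | conj (p q : Form N)
  | disj (p q : Form N)

/-- A static delegation: `D n φ` says that the atomic principal `n` delegates its authority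
to `φ`, so that `φ` acts for `n`. -/
abbrev Delegation (N : Type u) := N → Form N → Prop

/-- The acts-for relation `p ≽ q` on formulas: the lattice rules (with distributivity, so that
formulas have conjunctive normal forms) together with the static delegations. -/
inductive Form.ActsFor {N : Type u} (D : Delegation N) : Form N → Form N → Prop where
  | bot (p : Form N) : ActsFor D p .bot
  | top (p : Form N) : ActsFor D .top p
  | refl (p : Form N) : ActsFor D p p
  | conjL₁ {p₁ p₂ q : Form N} : ActsFor D p₁ q → ActsFor D (.conj p₁ p₂) q
  | conjL₂ {p₁ p₂ q : Form N} : ActsFor D p₂ q → ActsFor D (.conj p₁ p₂) q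
  | conjR {p q₁ q₂ : Form N} : ActsFor D p q₁ → ActsFor D p q₂ → ActsFor D p (.conj q₁ q₂)
  | disjL {p₁ p₂ q : Form N} : ActsFor D p₁ q → ActsFor D p₂ q → ActsFor D (.disj p₁ p₂) q
  | disjR₁ {p q₁ q₂ : Form N} : ActsFor D p q₁ → ActsFor D p (.disj q₁ q₂)
  | disjR₂ {p q₁ q₂ : Form N} : ActsFor D p q₂ → ActsFor D p (.disj q₁ q₂)
  | trans {p q r : Form N} : ActsFor D p q → ActsFor D q r → ActsFor D p r
  | distrib (p q r : Form N) :
      ActsFor D (.conj (.disj p q) (.disj p r)) (.disj p (.conj q r))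
  | deleg {n : N} {φ : Form N} : D n φ → ActsFor D φ (.atom n)

/-- Formulas that act for each other are identified. -/
def formSetoid {N : Type u} (D : Delegation N) : Setoid (Form N) where
  r p q := Form.ActsFor D p q ∧ Form.ActsFor D q p
  iseqv :=
    { refl := fun p => ⟨.refl p, .refl p⟩
      symm := fun h => ⟨h.2, h.1⟩
      trans := fun h k => ⟨.trans h.1 k.1, .trans k.2 h.2⟩ }

/-- The lattice of authority: formulas modulo mutual acts-for. -/
def Authority {N : Type u} (D : Delegation N) := Quotient (formSetoid D)

namespace Authority
variable {N : Type u} {D : Delegation N}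

def mk (p : Form N) : Authority D := Quotient.mk (formSetoid D) p

def ActsFor (a b : Authority D) : Prop :=
  Quotient.liftOn₂ a b (fun p q => Form.ActsFor D p q) (by
    intro p q p' q' hp hq
    exact propext ⟨fun h => .trans hp.2 (.trans h hq.1), fun h => .trans hp.1 (.trans h hq.2)⟩)

def top : Authority D := mk .top

def bot : Authority D := mk .bot

def conj (a b : Authority D) : Authority D :=
  Quotient.liftOn₂ a b (fun p q => mk (.conj p q)) (by
    intro p q p' q' hp hq
    exact Quotient.sound
      ⟨.conjR (.conjL₁ hp.1) (.conjL₂ hq.1), .conjR (.conjL₁ hp.2) (.conjL₂ hq.2)⟩)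

def disj (a b : Authority D) : Authority D :=
  Quotient.liftOn₂ a b (fun p q => mk (.disj p q)) (by
    intro p q p' q' hp hq
    exact Quotient.sound
      ⟨.disjL (.disjR₁ hp.1) (.disjR₂ hq.1), .disjL (.disjR₁ hp.2) (.disjR₂ hq.2)⟩)

end Authority

/-- A principal or label, in its normal form `p^→ ∧ q^←`: `conf` is `p` and `integ` is `q`. -/
structure Label {N : Type u} (D : Delegation N) where
  conf : Authority D
  integ : Authority D

namespace Label
variable {N : Type u} {D : Delegation N}

def atom (n : N) : Label D := ⟨.mk (.atom n), .mk (.atom n)⟩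

def top : Label D := ⟨.top, .top⟩

def bot : Label D := ⟨.bot, .bot⟩

/-- The projection `ℓ^π`. -/
def proj (π : Aspect) (l : Label D) : Label D :=
  match π with
  | .conf => ⟨l.conf, .bot⟩
  | .integ => ⟨.bot, l.integ⟩

def conj (l m : Label D) : Label D := ⟨l.conf.conj m.conf, l.integ.conj m.integ⟩

def disj (l m : Label D) : Label D := ⟨l.conf.disj m.conf, l.integ.disj m.integ⟩

/-- The join `⊔` of the information flow lattice. -/
def join (l m : Label D) : Label D := ⟨l.conf.conj m.conf, l.integ.disj m.integ⟩

/-- The meet `⊓` of the information flow lattice. -/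
def meet (l m : Label D) : Label D := ⟨l.conf.disj m.conf, l.integ.conj m.integ⟩

/-- The trust ordering `l ≽ m`. -/
def ActsFor (l m : Label D) : Prop := l.conf.ActsFor m.conf ∧ l.integ.ActsFor m.integ

/-- The information flow ordering `l ⊑ m`: more confidentiality and less integrity. -/
def FlowsTo (l m : Label D) : Prop := m.conf.ActsFor l.conf ∧ l.integ.ActsFor m.integ

/-- The view `Δ(p^→ ∧ q^←) = q^→`. -/
def view (l : Label D) : Label D := ⟨l.integ, .bot⟩

/-- The voice `∇(p^→ ∧ q^←) = p^←`. -/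
def voice (l : Label D) : Label D := ⟨.bot, l.conf⟩

end Label

/-! ## Syntax

Variables are de Bruijn indices.  Terms are in Church style: `η` terms carry the type of their
content and injections carry both summands, so that a term has at most one type in a context. -/

/-- A renaming carried under one binder. -/
def upRen (ξ : ℕ → ℕ) : ℕ → ℕ
  | 0 => 0
  | k + 1 => ξ k + 1

/-- Types; `labeled l τ` is the type `l says τ`. -/
inductive Ty {N : Type u} (D : Delegation N) where
  | unit
  | tvar (k : ℕ)
  | sum (τ₁ τ₂ : Ty D)
  | prod (τ₁ τ₂ : Ty D)
  | fn (τ₁ : Ty D) (pc : Label D) (τ₂ : Ty D)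
  | all (pc : Label D) (τ : Ty D)
  | labeled (l : Label D) (τ : Ty D)

namespace Ty
variable {N : Type u} {D : Delegation N}

def rename (ξ : ℕ → ℕ) : Ty D → Ty D
  | unit => unit
  | tvar k => tvar (ξ k)
  | sum τ₁ τ₂ => sum (τ₁.rename ξ) (τ₂.rename ξ)
  | prod τ₁ τ₂ => prod (τ₁.rename ξ) (τ₂.rename ξ)
  | fn τ₁ pc τ₂ => fn (τ₁.rename ξ) pc (τ₂.rename ξ)
  | all pc τ => all pc (τ.rename (upRen ξ))
  | labeled l τ => labeled l (τ.rename ξ)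

/-- Weakening by one type variable. -/
def shift (τ : Ty D) : Ty D := τ.rename Nat.succ

/-- A substitution carried under one type binder. -/
def up (θ : ℕ → Ty D) : ℕ → Ty D
  | 0 => tvar 0
  | k + 1 => (θ k).shift

def subst (θ : ℕ → Ty D) : Ty D → Ty D
  | unit => unit
  | tvar k => θ k
  | sum τ₁ τ₂ => sum (τ₁.subst θ) (τ₂.subst θ)
  | prod τ₁ τ₂ => prod (τ₁.subst θ) (τ₂.subst θ)
  | fn τ₁ pc τ₂ => fn (τ₁.subst θ) pc (τ₂.subst θ)
  | all pc τ => all pc (τ.subst (up θ))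
  | labeled l τ => labeled l (τ.subst θ)

/-- The substitution of `τ` for the innermost type variable. -/
def single (τ : Ty D) : ℕ → Ty D
  | 0 => τ
  | k + 1 => tvar k

/-- All type variables are among the `n` innermost ones. -/
def WF : ℕ → Ty D → Prop
  | _, unit => True
  | n, tvar k => k < n
  | n, sum τ₁ τ₂ => τ₁.WF n ∧ τ₂.WF n
  | n, prod τ₁ τ₂ => τ₁.WF n ∧ τ₂.WF n
  | n, fn τ₁ _ τ₂ => τ₁.WF n ∧ τ₂.WF n
  | n, all _ τ => τ.WF (n + 1)
  | n, labeled _ τ => τ.WF n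

end Ty

/-- Expressions.  `ret l τ e` is the source-level unit term `η_l e` with content of type `τ`, and
`vret l τ v` the run-time value.  An index `i : Bool` stands for `1` (`false`) or `2` (`true`).
`bullet τ` is the mark `•` for an invisible value of type `τ`; it occurs only in low equivalence,
and no well-typed term contains it. -/
inductive Tm {N : Type u} (D : Delegation N) where
  | var (k : ℕ)
  | unit
  | lam (τ : Ty D) (pc : Label D) (e : Tm D)
  | app (e₁ e₂ : Tm D)
  | tlam (pc : Label D) (e : Tm D)
  | tapp (e : Tm D) (τ : Ty D)
  | pair (e₁ e₂ : Tm D)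
  | proj (i : Bool) (e : Tm D)
  | inj (i : Bool) (τ₁ τ₂ : Ty D) (e : Tm D)
  | case (e e₁ e₂ : Tm D)
  | ret (l : Label D) (τ : Ty D) (e : Tm D)
  | vret (l : Label D) (τ : Ty D) (v : Tm D)
  | bind (e e' : Tm D)
  | decl (e : Tm D) (l : Label D)
  | endorse (e : Tm D) (l : Label D)
  | bullet (τ : Ty D)

namespace Tm
variable {N : Type u} {D : Delegation N}

inductive IsValue : Tm D → Prop where
  | unit : IsValue unit
  | inj {i : Bool} {τ₁ τ₂ : Ty D} {v : Tm D} : IsValue v → IsValue (inj i τ₁ τ₂ v)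
  | pair {v₁ v₂ : Tm D} : IsValue v₁ → IsValue v₂ → IsValue (pair v₁ v₂)
  | vret {l : Label D} {τ : Ty D} {v : Tm D} : IsValue v → IsValue (vret l τ v)
  | lam {τ : Ty D} {pc : Label D} {e : Tm D} : IsValue (lam τ pc e)
  | tlam {pc : Label D} {e : Tm D} : IsValue (tlam pc e)

/-- The expression contains no `decl` expression. -/
def DeclFree : Tm D → Prop
  | var _ => True
  | unit => True
  | lam _ _ e => e.DeclFree
  | app e₁ e₂ => e₁.DeclFree ∧ e₂.DeclFree
  | tlam _ e => e.DeclFree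
  | tapp e _ => e.DeclFree
  | pair e₁ e₂ => e₁.DeclFree ∧ e₂.DeclFree
  | proj _ e => e.DeclFree
  | inj _ _ _ e => e.DeclFree
  | case e e₁ e₂ => e.DeclFree ∧ e₁.DeclFree ∧ e₂.DeclFree
  | ret _ _ e => e.DeclFree
  | vret _ _ v => v.DeclFree
  | bind e e' => e.DeclFree ∧ e'.DeclFree
  | decl _ _ => False
  | endorse e _ => e.DeclFree
  | bullet _ => True

/-- Substitution of types for type variables. -/
def tsubst (θ : ℕ → Ty D) : Tm D → Tm D
  | var k => var k
  | unit => unit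
  | lam τ pc e => lam (τ.subst θ) pc (e.tsubst θ)
  | app e₁ e₂ => app (e₁.tsubst θ) (e₂.tsubst θ)
  | tlam pc e => tlam pc (e.tsubst (Ty.up θ))
  | tapp e τ => tapp (e.tsubst θ) (τ.subst θ)
  | pair e₁ e₂ => pair (e₁.tsubst θ) (e₂.tsubst θ)
  | proj i e => proj i (e.tsubst θ)
  | inj i τ₁ τ₂ e => inj i (τ₁.subst θ) (τ₂.subst θ) (e.tsubst θ)
  | case e e₁ e₂ => case (e.tsubst θ) (e₁.tsubst θ) (e₂.tsubst θ)
  | ret l τ e => ret l (τ.subst θ) (e.tsubst θ)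
  | vret l τ v => vret l (τ.subst θ) (v.tsubst θ)
  | bind e e' => bind (e.tsubst θ) (e'.tsubst θ)
  | decl e l => decl (e.tsubst θ) l
  | endorse e l => endorse (e.tsubst θ) l
  | bullet τ => bullet (τ.subst θ)

/-- Renaming of term variables. -/
def rename (ξ : ℕ → ℕ) : Tm D → Tm D
  | var k => var (ξ k)
  | unit => unit
  | lam τ pc e => lam τ pc (e.rename (upRen ξ))
  | app e₁ e₂ => app (e₁.rename ξ) (e₂.rename ξ)
  | tlam pc e => tlam pc (e.rename ξ)
  | tapp e τ => tapp (e.rename ξ) τ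
  | pair e₁ e₂ => pair (e₁.rename ξ) (e₂.rename ξ)
  | proj i e => proj i (e.rename ξ)
  | inj i τ₁ τ₂ e => inj i τ₁ τ₂ (e.rename ξ)
  | case e e₁ e₂ => case (e.rename ξ) (e₁.rename (upRen ξ)) (e₂.rename (upRen ξ))
  | ret l τ e => ret l τ (e.rename ξ)
  | vret l τ v => vret l τ (v.rename ξ)
  | bind e e' => bind (e.rename ξ) (e'.rename (upRen ξ))
  | decl e l => decl (e.rename ξ) l
  | endorse e l => endorse (e.rename ξ) l
  | bullet τ => bullet τ

/-- A substitution carried under one term binder. -/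
def up (σ : ℕ → Tm D) : ℕ → Tm D
  | 0 => var 0
  | k + 1 => (σ k).rename Nat.succ

/-- Capture-avoiding substitution of terms for term variables. -/
def subst (σ : ℕ → Tm D) : Tm D → Tm D
  | var k => σ k
  | unit => unit
  | lam τ pc e => lam τ pc (e.subst (up σ))
  | app e₁ e₂ => app (e₁.subst σ) (e₂.subst σ)
  | tlam pc e => tlam pc (e.subst (fun k => (σ k).tsubst (fun j => .tvar (j + 1))))
  | tapp e τ => tapp (e.subst σ) τ
  | pair e₁ e₂ => pair (e₁.subst σ) (e₂.subst σ)
  | proj i e => proj i (e.subst σ)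
  | inj i τ₁ τ₂ e => inj i τ₁ τ₂ (e.subst σ)
  | case e e₁ e₂ => case (e.subst σ) (e₁.subst (up σ)) (e₂.subst (up σ))
  | ret l τ e => ret l τ (e.subst σ)
  | vret l τ v => vret l τ (v.subst σ)
  | bind e e' => bind (e.subst σ) (e'.subst (up σ))
  | decl e l => decl (e.subst σ) l
  | endorse e l => endorse (e.subst σ) l
  | bullet τ => bullet τ

/-- `e[x ↦ v]` for the innermost variable `x`. -/
def inst (e v : Tm D) : Tm D :=
  e.subst (fun k => match k with
    | 0 => v
    | j + 1 => var j)

/-- `e[x ↦ v][y ↦ w]` for the two innermost variables, in a context `Γ, x, y`;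
here `v` and `w` live in `Γ`. -/
def inst₂ (e v w : Tm D) : Tm D :=
  e.subst (fun k => match k with
    | 0 => w
    | 1 => v
    | j + 2 => var j)

end Tm

/-! ## Operational semantics -/

/-- Trace events: no event, a protected value (or an input value), or a downgrade of aspect `π`
of the value `v : τ` from the label `l'` to the label `l`. -/
inductive Event {N : Type u} (D : Delegation N) where
  | bullet
  | val (v : Tm D)
  | down (π : Aspect) (l' l : Label D) (τ : Ty D) (v : Tm D)

/-- Traces form the free monoid over events. -/
abbrev Trace {N : Type u} (D : Delegation N) := List (Event D)

section Semantics
variable {N : Type u} {D : Delegation N}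

inductive Red : Tm D → Tm D → Prop where
  | app {τ : Ty D} {pc : Label D} {e v : Tm D} : v.IsValue →
      Red (.app (.lam τ pc e) v) (e.inst v)
  | tapp {pc : Label D} {e : Tm D} {τ : Ty D} :
      Red (.tapp (.tlam pc e) τ) (e.tsubst (Ty.single τ))
  | proj {i : Bool} {v₁ v₂ : Tm D} : v₁.IsValue → v₂.IsValue →
      Red (.proj i (.pair v₁ v₂)) (bif i then v₂ else v₁)
  | case {i : Bool} {τ₁ τ₂ : Ty D} {v e₁ e₂ : Tm D} : v.IsValue →
      Red (.case (.inj i τ₁ τ₂ v) e₁ e₂) ((bif i then e₂ else e₁).inst v)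
  | bind {l : Label D} {τ : Ty D} {v e : Tm D} : v.IsValue →
      Red (.bind (.vret l τ v) e) (e.inst v)

/-- Evaluation contexts. -/
inductive ECtx (D : Delegation N) where
  | hole
  | appL (E : ECtx D) (e : Tm D)
  | appR (v : Tm D) (hv : v.IsValue) (E : ECtx D)
  | tapp (E : ECtx D) (τ : Ty D)
  | pairL (E : ECtx D) (e : Tm D)
  | pairR (v : Tm D) (hv : v.IsValue) (E : ECtx D)
  | ret (l : Label D) (τ : Ty D) (E : ECtx D)
  | proj (i : Bool) (E : ECtx D)
  | inj (i : Bool) (τ₁ τ₂ : Ty D) (E : ECtx D)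
  | bind (E : ECtx D) (e : Tm D)
  | case (E : ECtx D) (e₁ e₂ : Tm D)
  | decl (E : ECtx D) (l : Label D)
  | endorse (E : ECtx D) (l : Label D)

def ECtx.fill : ECtx D → Tm D → Tm D
  | hole, a => a
  | appL E e, a => .app (E.fill a) e
  | appR v _ E, a => .app v (E.fill a)
  | tapp E τ, a => .tapp (E.fill a) τ
  | pairL E e, a => .pair (E.fill a) e
  | pairR v _ E, a => .pair v (E.fill a)
  | ret l τ E, a => .ret l τ (E.fill a)
  | proj i E, a => .proj i (E.fill a)
  | inj i τ₁ τ₂ E, a => .inj i τ₁ τ₂ (E.fill a)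
  | bind E e, a => .bind (E.fill a) e
  | case E e₁ e₂, a => .case (E.fill a) e₁ e₂
  | decl E l, a => .decl (E.fill a) l
  | endorse E l, a => .endorse (E.fill a) l

/-- One step `⟨e, t⟩ ⟶ ⟨e', t'⟩`. -/
inductive Step : Tm D × Trace D → Tm D × Trace D → Prop where
  | red {e e' : Tm D} {t : Trace D} : Red e e' → Step (e, t) (e', t ++ [.bullet])
  | unitM {l : Label D} {τ : Ty D} {v : Tm D} {t : Trace D} : v.IsValue →
      Step (.ret l τ v, t) (.vret l τ v, t ++ [.val (.vret l τ v)])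
  | decl {l' l : Label D} {τ : Ty D} {v : Tm D} {t : Trace D} : v.IsValue →
      Step (.decl (.vret l' τ v) l, t) (.vret l τ v, t ++ [.down .conf l' l τ v])
  | endorse {l' l : Label D} {τ : Ty D} {v : Tm D} {t : Trace D} : v.IsValue →
      Step (.endorse (.vret l' τ v) l, t) (.vret l τ v, t ++ [.down .integ l' l τ v])
  | eval {e e' : Tm D} {t t' : Trace D} (E : ECtx D) : Step (e, t) (e', t') →
      Step (E.fill e, t) (E.fill e', t')

/-- `⟨e[x ↦ v][y ↦ w], v; w⟩ ⟶* ⟨u, t⟩` for some value `u`. -/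
def Runs (e v w : Tm D) (t : Trace D) : Prop :=
  ∃ u : Tm D, u.IsValue ∧
    Relation.ReflTransGen Step (e.inst₂ v w, [.val v, .val w]) (u, t)

/-! ## Type system -/

/-- The type `τ` protects the label `l`. -/
inductive Protects : Label D → Ty D → Prop where
  | unit (l : Label D) : Protects l .unit
  | lbl {l' l : Label D} {τ : Ty D} : l'.FlowsTo l → Protects l' (.labeled l τ)
  | pair {l : Label D} {τ₁ τ₂ : Ty D} : Protects l τ₁ → Protects l τ₂ →
      Protects l (.prod τ₁ τ₂)

/-- The typing judgement `Γ; pc ⊢ e : τ`; the context consists of `n` type variables and of the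
list `Γ` of the types of the term variables, the innermost first. -/
inductive HasType : ℕ → List (Ty D) → Label D → Tm D → Ty D → Prop where
  | var {n : ℕ} {Γ : List (Ty D)} {pc : Label D} {k : ℕ} {τ : Ty D} :
      Γ[k]? = some τ → HasType n Γ pc (.var k) τ
  | unit {n : ℕ} {Γ : List (Ty D)} {pc : Label D} : HasType n Γ pc .unit .unit
  | lam {n : ℕ} {Γ : List (Ty D)} {pc pc' : Label D} {τ₁ τ₂ : Ty D} {e : Tm D} :
      HasType n (τ₁ :: Γ) pc' e τ₂ → HasType n Γ pc (.lam τ₁ pc' e) (.fn τ₁ pc' τ₂)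
  | app {n : ℕ} {Γ : List (Ty D)} {pc pc' : Label D} {τ' τ : Ty D} {e₁ e₂ : Tm D} :
      HasType n Γ pc e₁ (.fn τ' pc' τ) → HasType n Γ pc e₂ τ' → pc.FlowsTo pc' →
      HasType n Γ pc (.app e₁ e₂) τ
  | tlam {n : ℕ} {Γ : List (Ty D)} {pc pc' : Label D} {τ : Ty D} {e : Tm D} :
      HasType (n + 1) (Γ.map Ty.shift) pc' e τ → HasType n Γ pc (.tlam pc' e) (.all pc' τ)
  | tapp {n : ℕ} {Γ : List (Ty D)} {pc pc' : Label D} {τ τ' : Ty D} {e : Tm D} :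
      HasType n Γ pc e (.all pc' τ) → pc.FlowsTo pc' → τ'.WF n →
      HasType n Γ pc (.tapp e τ') (τ.subst (Ty.single τ'))
  | pair {n : ℕ} {Γ : List (Ty D)} {pc : Label D} {τ₁ τ₂ : Ty D} {e₁ e₂ : Tm D} :
      HasType n Γ pc e₁ τ₁ → HasType n Γ pc e₂ τ₂ →
      HasType n Γ pc (.pair e₁ e₂) (.prod τ₁ τ₂)
  | proj {n : ℕ} {Γ : List (Ty D)} {pc : Label D} {i : Bool} {τ₁ τ₂ : Ty D} {e : Tm D} :
      HasType n Γ pc e (.prod τ₁ τ₂) → HasType n Γ pc (.proj i e) (bif i then τ₂ else τ₁)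
  | inj {n : ℕ} {Γ : List (Ty D)} {pc : Label D} {i : Bool} {τ₁ τ₂ : Ty D} {e : Tm D} :
      HasType n Γ pc e (bif i then τ₂ else τ₁) →
      HasType n Γ pc (.inj i τ₁ τ₂ e) (.sum τ₁ τ₂)
  | case {n : ℕ} {Γ : List (Ty D)} {pc : Label D} {τ₁ τ₂ τ : Ty D} {e e₁ e₂ : Tm D} :
      HasType n Γ pc e (.sum τ₁ τ₂) → Protects pc τ →
      HasType n (τ₁ :: Γ) pc e₁ τ → HasType n (τ₂ :: Γ) pc e₂ τ →
      HasType n Γ pc (.case e e₁ e₂) τ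
  | unitM {n : ℕ} {Γ : List (Ty D)} {pc l : Label D} {τ : Ty D} {e : Tm D} :
      HasType n Γ pc e τ → pc.FlowsTo l → HasType n Γ pc (.ret l τ e) (.labeled l τ)
  | vunitM {n : ℕ} {Γ : List (Ty D)} {pc l : Label D} {τ : Ty D} {v : Tm D} :
      v.IsValue → HasType n Γ pc v τ → HasType n Γ pc (.vret l τ v) (.labeled l τ)
  | bindM {n : ℕ} {Γ : List (Ty D)} {pc l : Label D} {τ' τ : Ty D} {e e' : Tm D} :
      HasType n Γ pc e (.labeled l τ') → Protects l τ →
      HasType n (τ' :: Γ) (pc.join l) e' τ → HasType n Γ pc (.bind e e') τ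
  | decl {n : ℕ} {Γ : List (Ty D)} {pc l' l : Label D} {τ : Ty D} {e : Tm D} :
      HasType n Γ pc e (.labeled l' τ) → l'.proj .integ = l.proj .integ → pc.FlowsTo l →
      (l'.proj .conf).FlowsTo ((l.proj .conf).join ((l'.join pc).proj .integ).view) →
      HasType n Γ pc (.decl e l) (.labeled l τ)
  | endorse {n : ℕ} {Γ : List (Ty D)} {pc l' l : Label D} {τ : Ty D} {e : Tm D} :
      HasType n Γ pc e (.labeled l' τ) → l'.proj .conf = l.proj .conf → pc.FlowsTo l →
      (l'.proj .integ).FlowsTo ((l.proj .integ).join ((l'.join pc).proj .conf).voice) →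
      HasType n Γ pc (.endorse e l) (.labeled l τ)

/-! ## Attackers -/

/-- `𝒜^π`: the principals whose aspect `π` the attacker has. -/
def aspectOf (A : Set (Label D)) (π : Aspect) : Set (Label D) :=
  {p | ∃ q : Label D, (p.proj π).conj (q.proj π.opp) ∈ A}

/-- Attackers, as sets of principals. -/
structure IsAttacker (A : Set (Label D)) : Prop where
  /-- An attacker that has a principal has every principal that it acts for. -/
  closed : ∀ p ∈ A, ∀ q : Label D, p.ActsFor q → q ∈ A
  /-- Attacking principals may collude. -/
  conj_mem : ∀ π, ∀ a₁ ∈ aspectOf A π, ∀ a₂ ∈ aspectOf A π, a₁.conj a₂ ∈ aspectOf A π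
  /-- Attackers may attenuate their power. -/
  disj_mem : ∀ π, ∀ a ∈ aspectOf A π, ∀ b : Label D, a.disj b ∈ aspectOf A π
  disj_not_mem : ∀ π, ∀ b₁ ∉ aspectOf A π, ∀ b₂ ∉ aspectOf A π, b₁.disj b₂ ∉ aspectOf A π
  conj_not_mem : ∀ π, ∀ a : Label D, ∀ b ∉ aspectOf A π, a.conj b ∉ aspectOf A π
  /-- Attackers have the same power in confidentiality and integrity. -/
  voice_view : ∀ a ∈ A, (a.proj .conf).voice.conj (a.proj .integ).view ∈ A

/-- The untrusted high set induced by an attacker. -/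
def untrusted (A : Set (Label D)) : Set (Label D) := {l | l.proj .integ ∈ A}

/-- The secret high set induced by an attacker. -/
def secret (A : Set (Label D)) : Set (Label D) := {l | l.proj .conf ∉ A}

def trusted (A : Set (Label D)) : Set (Label D) := (untrusted A)ᶜ

/-- The labels that are both trusted and public. -/
def lowSet (A : Set (Label D)) : Set (Label D) := (untrusted A)ᶜ ∩ (secret A)ᶜ

/-- `τ` is a high type for the high set `H`. -/
def HighType (H : Set (Label D)) (τ : Ty D) : Prop := ∃ h ∈ H, Protects h τ

/-! ## Low equivalence -/

/-- Low equivalence: the smallest congruence that identifies every value `η_l v` with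
`l` outside `Lo` with the mark `•` of its type. -/
inductive Equiv (Lo : Set (Label D)) : Tm D → Tm D → Prop where
  | hide {l : Label D} {τ : Ty D} {v : Tm D} : l ∉ Lo →
      Equiv Lo (.vret l τ v) (.bullet (.labeled l τ))
  | refl (e : Tm D) : Equiv Lo e e
  | symm {e e' : Tm D} : Equiv Lo e e' → Equiv Lo e' e
  | trans {e e' e'' : Tm D} : Equiv Lo e e' → Equiv Lo e' e'' → Equiv Lo e e''
  | lam {τ : Ty D} {pc : Label D} {e e' : Tm D} : Equiv Lo e e' →
      Equiv Lo (.lam τ pc e) (.lam τ pc e')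
  | app {e₁ e₁' e₂ e₂' : Tm D} : Equiv Lo e₁ e₁' → Equiv Lo e₂ e₂' →
      Equiv Lo (.app e₁ e₂) (.app e₁' e₂')
  | tlam {pc : Label D} {e e' : Tm D} : Equiv Lo e e' → Equiv Lo (.tlam pc e) (.tlam pc e')
  | tapp {τ : Ty D} {e e' : Tm D} : Equiv Lo e e' → Equiv Lo (.tapp e τ) (.tapp e' τ)
  | pair {e₁ e₁' e₂ e₂' : Tm D} : Equiv Lo e₁ e₁' → Equiv Lo e₂ e₂' →
      Equiv Lo (.pair e₁ e₂) (.pair e₁' e₂')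
  | proj {i : Bool} {e e' : Tm D} : Equiv Lo e e' → Equiv Lo (.proj i e) (.proj i e')
  | inj {i : Bool} {τ₁ τ₂ : Ty D} {e e' : Tm D} : Equiv Lo e e' →
      Equiv Lo (.inj i τ₁ τ₂ e) (.inj i τ₁ τ₂ e')
  | case {e e' e₁ e₁' e₂ e₂' : Tm D} : Equiv Lo e e' → Equiv Lo e₁ e₁' → Equiv Lo e₂ e₂' →
      Equiv Lo (.case e e₁ e₂) (.case e' e₁' e₂')
  | ret {l : Label D} {τ : Ty D} {e e' : Tm D} : Equiv Lo e e' →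
      Equiv Lo (.ret l τ e) (.ret l τ e')
  | vret {l : Label D} {τ : Ty D} {v v' : Tm D} : Equiv Lo v v' →
      Equiv Lo (.vret l τ v) (.vret l τ v')
  | bind {e₁ e₁' e₂ e₂' : Tm D} : Equiv Lo e₁ e₁' → Equiv Lo e₂ e₂' →
      Equiv Lo (.bind e₁ e₂) (.bind e₁' e₂')
  | decl {l : Label D} {e e' : Tm D} : Equiv Lo e e' → Equiv Lo (.decl e l) (.decl e' l)
  | endorse {l : Label D} {e e' : Tm D} : Equiv Lo e e' →
      Equiv Lo (.endorse e l) (.endorse e' l)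

/-- Low equivalence of events. -/
inductive EventEquiv (Lo : Set (Label D)) : Event D → Event D → Prop where
  | hideVal {l : Label D} {τ : Ty D} {v : Tm D} : l ∉ Lo →
      EventEquiv Lo (.val (.vret l τ v)) .bullet
  | hideDown {π : Aspect} {l' l : Label D} {τ : Ty D} {v : Tm D} : l ∉ Lo →
      EventEquiv Lo (.down π l' l τ v) .bullet
  | refl (c : Event D) : EventEquiv Lo c c
  | symm {c c' : Event D} : EventEquiv Lo c c' → EventEquiv Lo c' c
  | trans {c c' c'' : Event D} : EventEquiv Lo c c' → EventEquiv Lo c' c'' → EventEquiv Lo c c''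
  | val {v v' : Tm D} : Equiv Lo v v' → EventEquiv Lo (.val v) (.val v')
  | down {π : Aspect} {l' l : Label D} {τ : Ty D} {v v' : Tm D} : Equiv Lo v v' →
      EventEquiv Lo (.down π l' l τ v) (.down π l' l τ v')

/-- Low equivalence of traces. -/
inductive TraceEquiv (Lo : Set (Label D)) : Trace D → Trace D → Prop where
  | lift {c c' : Event D} : EventEquiv Lo c c' → TraceEquiv Lo [c] [c']
  | bulletR (t : Trace D) : TraceEquiv Lo (t ++ [.bullet]) t
  | bulletL (t : Trace D) : TraceEquiv Lo (.bullet :: t) t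
  | refl (t : Trace D) : TraceEquiv Lo t t
  | symm {t t' : Trace D} : TraceEquiv Lo t t' → TraceEquiv Lo t' t
  | trans {t t' t'' : Trace D} : TraceEquiv Lo t t' → TraceEquiv Lo t' t'' → TraceEquiv Lo t t''
  | append {t₁ t₁' t₂ t₂' : Trace D} : TraceEquiv Lo t₁ t₁' → TraceEquiv Lo t₂ t₂' →
      TraceEquiv Lo (t₁ ++ t₂) (t₁' ++ t₂')

/-! ## Transparent endorsement -/

/-- `v` is a value with `Γ; pc ⊢ v : τ`. -/
def IsInput (n : ℕ) (Γ : List (Ty D)) (pc : Label D) (τ : Ty D) (v : Tm D) : Prop :=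
  v.IsValue ∧ HasType n Γ pc v τ

/-- `v₁` is an irrelevant secret input (an irrelevant `→`-input) of `e` with respect to `A`.
The trace index `k i j` counts from zero, so the prefix that ends in that element
is `(t i j).take (k i j + 1)`. -/
def IrrelevantSecret (A : Set (Label D)) (n : ℕ) (Γ : List (Ty D)) (pc : Label D)
    (τx τy : Ty D) (e v₁ : Tm D) : Prop :=
  IsInput n Γ pc τx v₁ ∧
  ∃ (v w : Fin 2 → Tm D) (t : Fin 2 → Fin 2 → Trace D) (k : Fin 2 → Fin 2 → ℕ),
    v 0 = v₁ ∧ IsInput n Γ pc τx (v 1) ∧ (∀ j, IsInput n Γ pc τy (w j)) ∧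
    (∀ i j, Runs e (v i) (w j) (t i j)) ∧
    (∀ i j, ∃ c, (t i j)[k i j]? = some c ∧ ¬ EventEquiv (lowSet A) c .bullet) ∧
    (∀ i j i' j', TraceEquiv (lowSet A)
      ((t i j).take (k i j + 1)) ((t i' j').take (k i' j' + 1))) ∧
    TraceEquiv (trusted A) ((t 0 0).take (k 0 0 + 1)) ((t 0 1).take (k 0 1 + 1)) ∧
    ¬ TraceEquiv (trusted A) ((t 1 0).take (k 1 0 + 1)) ((t 1 1).take (k 1 1 + 1))

def RelevantSecret (A : Set (Label D)) (n : ℕ) (Γ : List (Ty D)) (pc : Label D)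
    (τx τy : Ty D) (e v₁ : Tm D) : Prop :=
  ¬ IrrelevantSecret A n Γ pc τx τy e v₁

/-- The program `e`, with a secret input `x : τx` and an untrusted input `y : τy`, transparently
endorses.  The attacks `w 0` and `w 1` perform no declassification of their own. -/
def TransparentlyEndorses (n : ℕ) (Γ : List (Ty D)) (pc : Label D)
    (τx τy : Ty D) (e : Tm D) : Prop :=
  ∀ A : Set (Label D), IsAttacker A →
    HighType (secret A) τx → HighType (untrusted A) τy →
    ∀ (v w : Fin 2 → Tm D) (t : Fin 2 → Fin 2 → Trace D),
      (∀ i, IsInput n Γ pc τx (v i)) →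
      (∀ j, IsInput n Γ pc τy (w j) ∧ (w j).DeclFree) →
      (∀ i j, Runs e (v i) (w j) (t i j)) →
      RelevantSecret A n Γ pc τx τy e (v 0) ∧ TraceEquiv (trusted A) (t 0 0) (t 0 1) →
      TraceEquiv (trusted A) (t 1 0) (t 1 1)

end Semantics

end NMIFC

/-! Suppose the two runs on the second secret, with the two attacks, differ for trusted observers.
The first difference is an endorsement, and cutting all four traces there exhibits the first secret
as irrelevant, which contradicts the hypothesis. Two noninterference statements give this, both
instances of `Big.simulation`: for a set `Lo` of visible labels into which nothing flows from
outside, runs of programs with equal erasures agree visibly until some downgrade from a hidden to a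
visible label releases different payloads.

Changing the attack, with `Lo` the trusted labels (`Runs.trusted_agree`): `decl` keeps integrity, so
only `endorse` can cross the boundary. Its nonmalleability premise and the primeness of attackers
force the crossing label to be public (`public_of_endorse`). So the runs agree, or first diverge at
an endorsement whose target lies in `lowSet`.

Changing the secret, with `Lo` the public labels (`Runs.public_agree`): `endorse` keeps
confidentiality, and every `decl` is buried in hidden data, so nothing crosses and the traces agree
publicly. Inside a hidden `bind` even a `decl` is harmless, because the program counter label is
hidden too.

To combine them, cut the second-secret traces right after the diverging endorsement. Public
agreement locates matching events in the first-secret traces. Trusted equality of those traces then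
makes all four prefixes equal at `lowSet` and the two first-secret prefixes equal for trusted
observers, while the two second-secret prefixes differ in their last payload.

The generated congruences are handled through normal forms (`Tm.erase`, `visibleTrace`), and small
steps through a big-step semantics with traces. -/

namespace NMIFC

variable {N : Type*} {D : Delegation N}

/-! ## Type substitution -/

namespace Ty

theorem rename_rename (τ : Ty D) (ξ ζ : ℕ → ℕ) :
    (τ.rename ξ).rename ζ = τ.rename (fun k => ζ (ξ k)) := by
  induction τ generalizing ξ ζ with
  | all pc τ ih =>
    simp only [rename, ih]
    congr 2
    funext k
    cases k <;> rfl
  | _ => simp_all [rename]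

theorem rename_subst (τ : Ty D) (ξ : ℕ → ℕ) (θ : ℕ → Ty D) :
    (τ.rename ξ).subst θ = τ.subst (fun k => θ (ξ k)) := by
  induction τ generalizing ξ θ with
  | all pc τ ih =>
    simp only [rename, subst, ih]
    congr 2
    funext k
    cases k <;> rfl
  | _ => simp_all [rename, subst]

theorem subst_rename (τ : Ty D) (θ : ℕ → Ty D) (ξ : ℕ → ℕ) :
    (τ.subst θ).rename ξ = τ.subst (fun k => (θ k).rename ξ) := by
  induction τ generalizing ξ θ with
  | all pc τ ih =>
    simp only [rename, subst, ih]
    congr 2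
    funext k
    cases k with
    | zero => rfl
    | succ k => simp [up, shift, rename_rename, upRen]
  | _ => simp_all [rename, subst]

theorem subst_subst (τ : Ty D) (θ ζ : ℕ → Ty D) :
    (τ.subst θ).subst ζ = τ.subst (fun k => (θ k).subst ζ) := by
  induction τ generalizing ζ θ with
  | all pc τ ih =>
    simp only [subst, ih]
    congr 2
    funext k
    cases k with
    | zero => rfl
    | succ k => simp [up, shift, rename_subst, subst_rename]
  | _ => simp_all [subst]

theorem subst_tvar (τ : Ty D) : τ.subst tvar = τ := by
  induction τ with
  | all pc τ ih =>
    have : up (tvar : ℕ → Ty D) = tvar := by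
      funext k
      cases k <;> rfl
    simp [subst, this, ih]
  | _ => simp_all [subst]

theorem shift_eq_subst (τ : Ty D) : τ.shift = τ.subst (fun k => tvar (k + 1)) := by
  have h := subst_rename τ tvar Nat.succ
  rw [subst_tvar] at h
  exact h

theorem shift_subst_single (τ τ' : Ty D) : τ.shift.subst (single τ') = τ := by
  rw [shift, rename_subst]
  exact subst_tvar τ

theorem shift_subst_up (τ : Ty D) (θ : ℕ → Ty D) :
    τ.shift.subst (up θ) = (τ.subst θ).shift := by
  rw [shift, shift, rename_subst, subst_rename]
  rfl

theorem subst_single_subst (τ τ' : Ty D) (θ : ℕ → Ty D) :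
    (τ.subst (single τ')).subst θ = (τ.subst (up θ)).subst (single (τ'.subst θ)) := by
  rw [subst_subst, subst_subst]
  congr 1
  funext k
  cases k with
  | zero => rfl
  | succ k => exact (shift_subst_single _ _).symm

theorem WF.rename {τ : Ty D} {n m : ℕ} {ξ : ℕ → ℕ} (h : τ.WF n) (hξ : ∀ k < n, ξ k < m) :
    (τ.rename ξ).WF m := by
  induction τ generalizing n m ξ with
  | all pc τ ih =>
    refine ih (n := n + 1) h fun k hk => ?_
    cases k with
    | zero => simp [upRen]
    | succ k => simpa [upRen] using hξ k (by omega)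
  | tvar k => exact hξ k h
  | unit => trivial
  | labeled l τ ih => exact ih h hξ
  | sum _ _ ih₁ ih₂ | prod _ _ ih₁ ih₂ | fn _ _ _ ih₁ ih₂ => exact ⟨ih₁ h.1 hξ, ih₂ h.2 hξ⟩

theorem WF.up {θ : ℕ → Ty D} {n m : ℕ} (hθ : ∀ k < n, (θ k).WF m) :
    ∀ k < n + 1, (Ty.up θ k).WF (m + 1) := by
  intro k hk
  cases k with
  | zero => simp [Ty.up, WF]
  | succ k => exact (hθ k (by omega)).rename fun _ h => Nat.succ_lt_succ h

theorem WF.subst {τ : Ty D} {n m : ℕ} {θ : ℕ → Ty D} (h : τ.WF n)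
    (hθ : ∀ k < n, (θ k).WF m) : (τ.subst θ).WF m := by
  induction τ generalizing n m θ with
  | all pc τ ih => exact ih (n := n + 1) h (WF.up hθ)
  | tvar k => exact hθ k h
  | unit => trivial
  | labeled l τ ih => exact ih h hθ
  | sum _ _ ih₁ ih₂ | prod _ _ ih₁ ih₂ | fn _ _ _ ih₁ ih₂ => exact ⟨ih₁ h.1 hθ, ih₂ h.2 hθ⟩

end Ty

/-! ## Values and typing under substitution -/

namespace Tm

theorem IsValue.rename {v : Tm D} (h : v.IsValue) (ξ : ℕ → ℕ) : (v.rename ξ).IsValue := by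
  induction h <;> constructor <;> assumption

theorem IsValue.tsubst {v : Tm D} (h : v.IsValue) (θ : ℕ → Ty D) : (v.tsubst θ).IsValue := by
  induction h <;> constructor <;> assumption

theorem IsValue.subst {v : Tm D} (h : v.IsValue) (σ : ℕ → Tm D) : (v.subst σ).IsValue := by
  induction h <;> constructor <;> assumption

theorem DeclFree.rename {e : Tm D} (h : e.DeclFree) (ξ : ℕ → ℕ) : (e.rename ξ).DeclFree := by
  induction e generalizing ξ <;> simp_all [DeclFree, Tm.rename]

theorem DeclFree.tsubst {e : Tm D} (h : e.DeclFree) (θ : ℕ → Ty D) : (e.tsubst θ).DeclFree := by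
  induction e generalizing θ <;> simp_all [DeclFree, Tm.tsubst]

theorem DeclFree.up {σ : ℕ → Tm D} (h : ∀ k, (σ k).DeclFree) : ∀ k, (Tm.up σ k).DeclFree
  | 0 => trivial
  | k + 1 => (h k).rename _

theorem DeclFree.subst {e : Tm D} (h : e.DeclFree) {σ : ℕ → Tm D} (hσ : ∀ k, (σ k).DeclFree) :
    (e.subst σ).DeclFree := by
  induction e generalizing σ with
  | tlam pc e ih => exact ih h fun k => (hσ k).tsubst _
  | lam τ pc e ih => exact ih h (DeclFree.up hσ)
  | case e e₁ e₂ ih ih₁ ih₂ =>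
    exact ⟨ih h.1 hσ, ih₁ h.2.1 (DeclFree.up hσ), ih₂ h.2.2 (DeclFree.up hσ)⟩
  | bind e e' ih ih' => exact ⟨ih h.1 hσ, ih' h.2 (DeclFree.up hσ)⟩
  | var k => exact hσ k
  | _ => simp_all [DeclFree, Tm.subst]

theorem DeclFree.inst {e v : Tm D} (h : e.DeclFree) (hv : v.DeclFree) : (e.inst v).DeclFree :=
  h.subst fun k => match k with
    | 0 => hv
    | _ + 1 => trivial

end Tm

theorem Protects.subst {l : Label D} {τ : Ty D} (h : Protects l τ) (θ : ℕ → Ty D) :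
    Protects l (τ.subst θ) := by
  induction h with
  | unit => exact .unit _
  | lbl h => exact .lbl h
  | pair _ _ ih₁ ih₂ => exact .pair ih₁ ih₂

/-! ### Substitution lemmas for the typing judgement. -/

namespace HasType

/-- The program counter label is irrelevant to the typing of values. -/
theorem value_pc {n : ℕ} {Γ : List (Ty D)} {pc : Label D} {v : Tm D} {τ : Ty D}
    (hv : v.IsValue) (h : HasType n Γ pc v τ) (pc' : Label D) : HasType n Γ pc' v τ := by
  induction hv generalizing τ with
  | unit => cases h; exact .unit
  | inj _ ih => cases h with | inj h => exact .inj (ih h)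
  | pair _ _ ih₁ ih₂ => cases h with | pair h₁ h₂ => exact .pair (ih₁ h₁) (ih₂ h₂)
  | vret hv ih => cases h with | vunitM _ h => exact .vunitM hv (ih h)
  | lam => cases h with | lam h => exact .lam h
  | tlam => cases h with | tlam h => exact .tlam h

theorem tsubst {n : ℕ} {Γ : List (Ty D)} {pc : Label D} {e : Tm D} {τ : Ty D}
    (h : HasType n Γ pc e τ) {m : ℕ} {θ : ℕ → Ty D} (hθ : ∀ k < n, (θ k).WF m) :
    HasType m (Γ.map (Ty.subst θ)) pc (e.tsubst θ) (τ.subst θ) := by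
  induction h generalizing m θ with
  | var h => exact .var (by simp [h])
  | unit => exact .unit
  | lam _ ih => exact .lam (ih hθ)
  | app _ _ hf ih₁ ih₂ => exact .app (ih₁ hθ) (ih₂ hθ) hf
  | tlam _ ih =>
    refine .tlam ?_
    have := ih (Ty.WF.up hθ)
    simpa [List.map_map, Function.comp_def, Ty.shift_subst_up] using this
  | tapp _ hf hw ih =>
    rw [Ty.subst_single_subst]
    exact .tapp (ih hθ) hf (hw.subst hθ)
  | pair _ _ ih₁ ih₂ => exact .pair (ih₁ hθ) (ih₂ hθ)
  | @proj _ _ _ i _ _ _ _ ih =>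
    have := HasType.proj (i := i) (ih hθ)
    cases i <;> exact this
  | @inj _ _ _ i _ _ _ _ ih =>
    refine .inj ?_
    have := ih hθ
    cases i <;> exact this
  | case _ hp _ _ ih ih₁ ih₂ => exact .case (ih hθ) (hp.subst θ) (ih₁ hθ) (ih₂ hθ)
  | unitM _ hf ih => exact .unitM (ih hθ) hf
  | vunitM hv _ ih => exact .vunitM (hv.tsubst θ) (ih hθ)
  | bindM _ hp _ ih ih' => exact .bindM (ih hθ) (hp.subst θ) (ih' hθ)
  | decl _ h₁ h₂ h₃ ih => exact .decl (ih hθ) h₁ h₂ h₃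
  | endorse _ h₁ h₂ h₃ ih => exact .endorse (ih hθ) h₁ h₂ h₃

theorem tsubst_shift {n : ℕ} {Γ : List (Ty D)} {pc : Label D} {e : Tm D} {τ : Ty D}
    (h : HasType n Γ pc e τ) :
    HasType (n + 1) (Γ.map Ty.shift) pc (e.tsubst fun j => .tvar (j + 1)) τ.shift := by
  have := h.tsubst (m := n + 1) (θ := fun j => .tvar (j + 1)) fun k hk => Nat.succ_lt_succ hk
  rw [Ty.shift_eq_subst, funext (f := Ty.shift) Ty.shift_eq_subst]
  exact this

theorem tsubst_single {n : ℕ} {Γ : List (Ty D)} {pc : Label D} {e : Tm D} {τ τ' : Ty D}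
    (h : HasType (n + 1) (Γ.map Ty.shift) pc e τ) (hw : τ'.WF n) :
    HasType n Γ pc (e.tsubst (Ty.single τ')) (τ.subst (Ty.single τ')) := by
  have := h.tsubst (m := n) (θ := Ty.single τ') fun k hk => by
    cases k with
    | zero => exact hw
    | succ k => exact Nat.lt_of_succ_lt_succ hk
  simpa [List.map_map, Function.comp_def, Ty.shift_subst_single] using this

theorem rename {n : ℕ} {Γ : List (Ty D)} {pc : Label D} {e : Tm D} {τ : Ty D}
    (h : HasType n Γ pc e τ) {Δ : List (Ty D)} {ξ : ℕ → ℕ}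
    (hξ : ∀ (k : ℕ) (τ : Ty D), Γ[k]? = some τ → Δ[ξ k]? = some τ) :
    HasType n Δ pc (e.rename ξ) τ := by
  have up : ∀ {Γ Δ : List (Ty D)} {ξ : ℕ → ℕ} (τ' : Ty D),
      (∀ (k : ℕ) (τ : Ty D), Γ[k]? = some τ → Δ[ξ k]? = some τ) →
      ∀ (k : ℕ) (τ : Ty D), (τ' :: Γ)[k]? = some τ → (τ' :: Δ)[upRen ξ k]? = some τ := by
    intro Γ Δ ξ τ' hξ k τ hk
    cases k with
    | zero => exact hk
    | succ k => exact hξ k τ hk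
  induction h generalizing Δ ξ with
  | var h => exact .var (hξ _ _ h)
  | unit => exact .unit
  | lam _ ih => exact .lam (ih (up _ hξ))
  | app _ _ hf ih₁ ih₂ => exact .app (ih₁ hξ) (ih₂ hξ) hf
  | tlam _ ih =>
    refine .tlam (ih fun k τ hk => ?_)
    rw [List.getElem?_map, Option.map_eq_some_iff] at hk ⊢
    obtain ⟨τ₀, h₀, rfl⟩ := hk
    exact ⟨τ₀, hξ _ _ h₀, rfl⟩
  | tapp _ hf hw ih => exact .tapp (ih hξ) hf hw
  | pair _ _ ih₁ ih₂ => exact .pair (ih₁ hξ) (ih₂ hξ)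
  | proj _ ih => exact .proj (ih hξ)
  | inj _ ih => exact .inj (ih hξ)
  | case _ hp _ _ ih ih₁ ih₂ => exact .case (ih hξ) hp (ih₁ (up _ hξ)) (ih₂ (up _ hξ))
  | unitM _ hf ih => exact .unitM (ih hξ) hf
  | vunitM hv _ ih => exact .vunitM (hv.rename ξ) (ih hξ)
  | bindM _ hp _ ih ih' => exact .bindM (ih hξ) hp (ih' (up _ hξ))
  | decl _ h₁ h₂ h₃ ih => exact .decl (ih hξ) h₁ h₂ h₃
  | endorse _ h₁ h₂ h₃ ih => exact .endorse (ih hξ) h₁ h₂ h₃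

/-- The typing of `σ k` is demanded at every program counter label because a variable may occur
under a binder or in a `bind` body, where the label differs. Values and variables meet this demand.
-/
theorem subst {n : ℕ} {Γ : List (Ty D)} {pc : Label D} {e : Tm D} {τ : Ty D}
    (h : HasType n Γ pc e τ) {Δ : List (Ty D)} {σ : ℕ → Tm D}
    (hσ : ∀ (k : ℕ) (τ : Ty D), Γ[k]? = some τ → ∀ pc, HasType n Δ pc (σ k) τ) :
    HasType n Δ pc (e.subst σ) τ := by
  have up : ∀ {n : ℕ} {Γ Δ : List (Ty D)} {σ : ℕ → Tm D} (τ' : Ty D),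
      (∀ (k : ℕ) (τ : Ty D), Γ[k]? = some τ → ∀ pc, HasType n Δ pc (σ k) τ) →
      ∀ (k : ℕ) (τ : Ty D), (τ' :: Γ)[k]? = some τ →
        ∀ pc, HasType n (τ' :: Δ) pc (Tm.up σ k) τ := by
    intro n Γ Δ σ τ' hσ k τ hk pc
    cases k with
    | zero => exact .var hk
    | succ k => exact (hσ k τ hk pc).rename fun _ _ h => h
  induction h generalizing Δ σ with
  | var h => exact hσ _ _ h _
  | unit => exact .unit
  | lam _ ih => exact .lam (ih (up _ hσ))
  | app _ _ hf ih₁ ih₂ => exact .app (ih₁ hσ) (ih₂ hσ) hf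
  | tlam _ ih =>
    refine .tlam (ih fun k τ hk pc => ?_)
    rw [List.getElem?_map, Option.map_eq_some_iff] at hk
    obtain ⟨τ₀, h₀, rfl⟩ := hk
    exact (hσ _ _ h₀ pc).tsubst_shift
  | tapp _ hf hw ih => exact .tapp (ih hσ) hf hw
  | pair _ _ ih₁ ih₂ => exact .pair (ih₁ hσ) (ih₂ hσ)
  | proj _ ih => exact .proj (ih hσ)
  | inj _ ih => exact .inj (ih hσ)
  | case _ hp _ _ ih ih₁ ih₂ => exact .case (ih hσ) hp (ih₁ (up _ hσ)) (ih₂ (up _ hσ))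
  | unitM _ hf ih => exact .unitM (ih hσ) hf
  | vunitM hv _ ih => exact .vunitM (hv.subst σ) (ih hσ)
  | bindM _ hp _ ih ih' => exact .bindM (ih hσ) hp (ih' (up _ hσ))
  | decl _ h₁ h₂ h₃ ih => exact .decl (ih hσ) h₁ h₂ h₃
  | endorse _ h₁ h₂ h₃ ih => exact .endorse (ih hσ) h₁ h₂ h₃

theorem inst {n : ℕ} {Γ : List (Ty D)} {pc pc' : Label D} {e v : Tm D} {τ τ' : Ty D}
    (h : HasType n (τ' :: Γ) pc e τ) (hv : v.IsValue) (hvt : HasType n Γ pc' v τ') :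
    HasType n Γ pc (e.inst v) τ := by
  refine h.subst fun k τ hk pc => ?_
  cases k with
  | zero =>
    cases hk
    exact hvt.value_pc hv pc
  | succ k => exact .var hk

theorem inst₂ {n : ℕ} {Γ : List (Ty D)} {pc pc' : Label D} {e v w : Tm D} {τ τx τy : Ty D}
    (h : HasType n (τy :: τx :: Γ) pc e τ) (hv : v.IsValue) (hvt : HasType n Γ pc' v τx)
    (hw : w.IsValue) (hwt : HasType n Γ pc' w τy) :
    HasType n Γ pc (e.inst₂ v w) τ := by
  refine h.subst fun k τ hk pc => ?_
  match k with
  | 0 =>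
    cases hk
    exact hwt.value_pc hw pc
  | 1 =>
    cases hk
    exact hvt.value_pc hv pc
  | k + 2 => exact .var hk

end HasType

/-! ## Erasure of invisible values -/

open Classical in
/-- The normal form of a term for `Equiv Lo`: every invisible value is replaced by its mark. -/
noncomputable def Tm.erase (Lo : Set (Label D)) : Tm D → Tm D
  | var k => var k
  | unit => unit
  | lam τ pc e => lam τ pc (e.erase Lo)
  | app e₁ e₂ => app (e₁.erase Lo) (e₂.erase Lo)
  | tlam pc e => tlam pc (e.erase Lo)
  | tapp e τ => tapp (e.erase Lo) τ
  | pair e₁ e₂ => pair (e₁.erase Lo) (e₂.erase Lo)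
  | proj i e => proj i (e.erase Lo)
  | inj i τ₁ τ₂ e => inj i τ₁ τ₂ (e.erase Lo)
  | case e e₁ e₂ => case (e.erase Lo) (e₁.erase Lo) (e₂.erase Lo)
  | ret l τ e => ret l τ (e.erase Lo)
  | vret l τ v => if l ∈ Lo then vret l τ (v.erase Lo) else bullet (.labeled l τ)
  | bind e e' => bind (e.erase Lo) (e'.erase Lo)
  | decl e l => decl (e.erase Lo) l
  | endorse e l => endorse (e.erase Lo) l
  | bullet τ => bullet τ

namespace Tm

theorem erase_vret_mem {Lo : Set (Label D)} {l : Label D} (hl : l ∈ Lo) (τ : Ty D) (v : Tm D) :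
    (vret l τ v).erase Lo = vret l τ (v.erase Lo) := by simp [erase, hl]

theorem erase_vret_not_mem {Lo : Set (Label D)} {l : Label D} (hl : l ∉ Lo) (τ : Ty D)
    (v : Tm D) : (vret l τ v).erase Lo = bullet (.labeled l τ) := by simp [erase, hl]

/-- Whatever is hidden at `Lo` is hidden at `Lo'`, so the coarser erasure factors through the finer
one. This is what lets trusted or public equality be restricted to `lowSet`. -/
theorem erase_erase {Lo Lo' : Set (Label D)} (h : Lo' ⊆ Lo) (e : Tm D) :
    (e.erase Lo).erase Lo' = e.erase Lo' := by
  induction e with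
  | vret l τ v ih =>
    by_cases hl : l ∈ Lo
    · by_cases hl' : l ∈ Lo' <;> simp [erase, hl, hl', ih]
    · have hl' : l ∉ Lo' := fun h' => hl (h h')
      simp [erase, hl, hl']
  | _ => simp_all [erase]

theorem equiv_erase (Lo : Set (Label D)) (e : Tm D) : Equiv Lo e (e.erase Lo) := by
  induction e with
  | vret l τ v ih =>
    by_cases hl : l ∈ Lo
    · rw [erase_vret_mem hl]
      exact .vret ih
    · rw [erase_vret_not_mem hl]
      exact .hide hl
  | var | unit | bullet => exact .refl _
  | lam _ _ _ ih => exact .lam ih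
  | app _ _ ih₁ ih₂ => exact .app ih₁ ih₂
  | tlam _ _ ih => exact .tlam ih
  | tapp _ _ ih => exact .tapp ih
  | pair _ _ ih₁ ih₂ => exact .pair ih₁ ih₂
  | proj _ _ ih => exact .proj ih
  | inj _ _ _ _ ih => exact .inj ih
  | case _ _ _ ih ih₁ ih₂ => exact .case ih ih₁ ih₂
  | ret _ _ _ ih => exact .ret ih
  | bind _ _ ih₁ ih₂ => exact .bind ih₁ ih₂
  | decl _ _ ih => exact .decl ih
  | endorse _ _ ih => exact .endorse ih

end Tm

/-- Every generating rule preserves erasures, and each term is equivalent to its own erasure. So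
erasure chooses one representative per class, and the congruence becomes an equation that can be
inverted constructor by constructor. -/
theorem equiv_iff_erase_eq {Lo : Set (Label D)} {e e' : Tm D} :
    Equiv Lo e e' ↔ e.erase Lo = e'.erase Lo := by
  constructor
  · intro h
    induction h with
    | hide hl => rw [Tm.erase_vret_not_mem hl, Tm.erase]
    | trans _ _ ih₁ ih₂ => exact ih₁.trans ih₂
    | _ => simp_all [Tm.erase]
  · intro h
    exact .trans (e.equiv_erase Lo) (h ▸ .symm (e'.equiv_erase Lo))

/-! ### Erasure commutes with renaming and substitution. -/

namespace Tm

theorem erase_rename (Lo : Set (Label D)) (e : Tm D) (ξ : ℕ → ℕ) :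
    (e.rename ξ).erase Lo = (e.erase Lo).rename ξ := by
  induction e generalizing ξ with
  | vret l τ v ih => by_cases hl : l ∈ Lo <;> simp [erase, rename, hl, ih]
  | _ => simp_all [erase, rename]

theorem erase_tsubst (Lo : Set (Label D)) (e : Tm D) (θ : ℕ → Ty D) :
    (e.tsubst θ).erase Lo = (e.erase Lo).tsubst θ := by
  induction e generalizing θ with
  | vret l τ v ih => by_cases hl : l ∈ Lo <;> simp [erase, tsubst, hl, ih, Ty.subst]
  | _ => simp_all [erase, tsubst]

theorem erase_up (Lo : Set (Label D)) (σ : ℕ → Tm D) :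
    (fun k => (up σ k).erase Lo) = up fun k => (σ k).erase Lo := by
  funext k
  cases k with
  | zero => rfl
  | succ k => exact erase_rename Lo _ _

theorem erase_subst (Lo : Set (Label D)) (e : Tm D) (σ : ℕ → Tm D) :
    (e.subst σ).erase Lo = (e.erase Lo).subst fun k => (σ k).erase Lo := by
  induction e generalizing σ with
  | vret l τ v ih => by_cases hl : l ∈ Lo <;> simp [erase, subst, hl, ih]
  | _ => simp_all [erase, subst, erase_up, erase_tsubst]

theorem erase_inst (Lo : Set (Label D)) (e v : Tm D) :
    (e.inst v).erase Lo = (e.erase Lo).inst (v.erase Lo) := by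
  rw [inst, inst, erase_subst]
  congr 1
  funext k
  cases k <;> rfl

theorem erase_inst₂ (Lo : Set (Label D)) (e v w : Tm D) :
    (e.inst₂ v w).erase Lo = (e.erase Lo).inst₂ (v.erase Lo) (w.erase Lo) := by
  rw [inst₂, inst₂, erase_subst]
  congr 1
  funext k
  match k with
  | 0 | 1 | _ + 2 => rfl

theorem DeclFree.erase {e : Tm D} (h : e.DeclFree) (Lo : Set (Label D)) :
    (e.erase Lo).DeclFree := by
  induction e with
  | vret l τ v ih => by_cases hl : l ∈ Lo <;> simp_all [Tm.erase, DeclFree]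
  | _ => simp_all [Tm.erase, DeclFree]

end Tm

/-- Terms in Church style: low-equivalent terms have the same type. -/
theorem HasType.unique {Lo : Set (Label D)} {n : ℕ} {Γ : List (Ty D)} {pc pc' : Label D}
    {e e' : Tm D} {τ τ' : Ty D} (h : HasType n Γ pc e τ) (h' : HasType n Γ pc' e' τ')
    (he : e.erase Lo = e'.erase Lo) : τ = τ' := by
  induction h generalizing pc' e' τ' with
  | @vunitM _ _ _ l _ _ _ _ ih =>
    by_cases hl : l ∈ Lo <;> cases h' <;> simp [Tm.erase, hl] at he <;> grind
  | _ => cases h' <;> simp [Tm.erase] at he <;> grind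

/-! ## Visible parts of traces -/

open Classical in
/-- The part of an event that is visible at `Lo`, if any. -/
noncomputable def Event.visible (Lo : Set (Label D)) : Event D → Option (Event D)
  | bullet => none
  -- The test is on the erasure and not on the shape of `v`: a bare hidden mark is equivalent to a
  -- hidden value, hence its event must also be invisible.
  | val v => if ∃ l τ, l ∉ Lo ∧ v.erase Lo = .bullet (.labeled l τ) then none
      else some (val (v.erase Lo))
  | down π l' l τ v => if l ∈ Lo then some (down π l' l τ (v.erase Lo)) else none

noncomputable def visibleTrace (Lo : Set (Label D)) (t : Trace D) : Trace D :=
  t.filterMap (Event.visible Lo)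

namespace Event

theorem visible_val_of_exists {Lo : Set (Label D)} {v : Tm D}
    (h : ∃ l τ, l ∉ Lo ∧ v.erase Lo = .bullet (.labeled l τ)) : (val v).visible Lo = none :=
  if_pos h

theorem visible_val_of_not_exists {Lo : Set (Label D)} {v : Tm D}
    (h : ¬ ∃ l τ, l ∉ Lo ∧ v.erase Lo = .bullet (.labeled l τ)) :
    (val v).visible Lo = some (val (v.erase Lo)) :=
  if_neg h

theorem visible_val_congr {Lo : Set (Label D)} {v v' : Tm D} (h : v.erase Lo = v'.erase Lo) :
    (val v).visible Lo = (val v').visible Lo := by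
  by_cases hv : ∃ l τ, l ∉ Lo ∧ v.erase Lo = .bullet (.labeled l τ)
  · rw [visible_val_of_exists hv, visible_val_of_exists (h ▸ hv)]
  · rw [visible_val_of_not_exists hv, visible_val_of_not_exists (h ▸ hv), h]

theorem visible_val_hidden {Lo : Set (Label D)} {l : Label D} (hl : l ∉ Lo) (τ : Ty D)
    (v : Tm D) : (val (.vret l τ v)).visible Lo = none :=
  visible_val_of_exists ⟨l, τ, hl, Tm.erase_vret_not_mem hl τ v⟩

theorem visible_down_mem {Lo : Set (Label D)} {l : Label D} (hl : l ∈ Lo) (π : Aspect)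
    (l' : Label D) (τ : Ty D) (v : Tm D) :
    (down π l' l τ v).visible Lo = some (down π l' l τ (v.erase Lo)) := by simp [visible, hl]

theorem visible_down_not_mem {Lo : Set (Label D)} {l : Label D} (hl : l ∉ Lo) (π : Aspect)
    (l' : Label D) (τ : Ty D) (v : Tm D) : (down π l' l τ v).visible Lo = none := by
  simp [visible, hl]

/-- The part visible at a smaller set is determined by the part visible at a larger one. -/
theorem visible_bind_visible {Lo Lo' : Set (Label D)} (h : Lo' ⊆ Lo) (c : Event D) :
    (c.visible Lo).bind (visible Lo') = c.visible Lo' := by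
  cases c with
  | bullet => rfl
  | val v =>
    by_cases hv : ∃ l τ, l ∉ Lo ∧ v.erase Lo = .bullet (.labeled l τ)
    · rw [visible_val_of_exists hv]
      obtain ⟨l, τ, hl, hv⟩ := hv
      refine (visible_val_of_exists ⟨l, τ, fun h' => hl (h h'), ?_⟩).symm
      rw [← Tm.erase_erase h, hv, Tm.erase]
    · rw [visible_val_of_not_exists hv, Option.bind_some]
      exact visible_val_congr (Tm.erase_erase h v)
  | down π l' l τ v =>
    by_cases hl : l ∈ Lo
    · simp [visible, hl, Tm.erase_erase h]
    · have hl' : l ∉ Lo' := fun h' => hl (h h')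
      simp [visible, hl, hl']

end Event

theorem eventEquiv_iff_visible_eq {Lo : Set (Label D)} {c c' : Event D} :
    EventEquiv Lo c c' ↔ c.visible Lo = c'.visible Lo := by
  have key : ∀ c : Event D, EventEquiv Lo c ((c.visible Lo).getD .bullet) := by
    intro c
    cases c with
    | bullet => exact .refl _
    | val v =>
      by_cases hv : ∃ l τ, l ∉ Lo ∧ v.erase Lo = .bullet (.labeled l τ)
      · obtain ⟨l, τ, hl, hv⟩ := hv
        rw [Event.visible_val_of_exists ⟨l, τ, hl, hv⟩]
        -- `v` may itself be a mark, to which `hideVal` does not apply, so the chain passes through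
        -- some hidden value with that mark. Its content is arbitrary and need not be typed.
        refine .trans (.val (v' := .vret l τ .unit) ?_) (.hideVal hl)
        rw [equiv_iff_erase_eq, hv, Tm.erase_vret_not_mem hl]
      · rw [Event.visible_val_of_not_exists hv]
        exact .val (v.equiv_erase Lo)
    | down π l' l τ v =>
      by_cases hl : l ∈ Lo
      · rw [Event.visible_down_mem hl]
        exact .down (v.equiv_erase Lo)
      · rw [Event.visible_down_not_mem hl]
        exact .hideDown hl
  constructor
  · intro h
    induction h with
    | hideVal hl => exact Event.visible_val_hidden hl _ _
    | hideDown hl => exact Event.visible_down_not_mem hl _ _ _ _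
    | refl => rfl
    | symm _ ih => exact ih.symm
    | trans _ _ ih₁ ih₂ => exact ih₁.trans ih₂
    | val h => exact Event.visible_val_congr (equiv_iff_erase_eq.1 h)
    | down h => simp [Event.visible, equiv_iff_erase_eq.1 h]
  · intro h
    exact .trans (key c) (h ▸ .symm (key c'))

theorem visibleTrace_append (Lo : Set (Label D)) (s t : Trace D) :
    visibleTrace Lo (s ++ t) = visibleTrace Lo s ++ visibleTrace Lo t :=
  List.filterMap_append ..

theorem visibleTrace_bullet (Lo : Set (Label D)) : visibleTrace Lo [.bullet] = [] := rfl

theorem visibleTrace_singleton (Lo : Set (Label D)) (c : Event D) :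
    visibleTrace Lo [c] = (c.visible Lo).toList := by
  cases h : c.visible Lo <;> simp [visibleTrace, h]

theorem visibleTrace_visibleTrace {Lo Lo' : Set (Label D)} (h : Lo' ⊆ Lo) (t : Trace D) :
    visibleTrace Lo' (visibleTrace Lo t) = visibleTrace Lo' t := by
  rw [visibleTrace, visibleTrace, List.filterMap_filterMap]
  exact List.filterMap_congr fun c _ => Event.visible_bind_visible h c

/-- The same normal-form argument for the free monoid: null events may be dropped anywhere, so only
the sequence of visible events, with erased payloads, remains. -/
theorem traceEquiv_iff_visibleTrace_eq {Lo : Set (Label D)} {t t' : Trace D} :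
    TraceEquiv Lo t t' ↔ visibleTrace Lo t = visibleTrace Lo t' := by
  have key : ∀ t : Trace D, TraceEquiv Lo t (visibleTrace Lo t) := by
    intro t
    induction t with
    | nil => exact .refl _
    | cons c t ih =>
      have hc : TraceEquiv Lo [c] (visibleTrace Lo [c]) := by
        cases h : c.visible Lo with
        | none =>
          rw [visibleTrace_singleton, h]
          refine .trans (.lift (c' := .bullet) ?_) (.bulletL [])
          rw [eventEquiv_iff_visible_eq, h]
          rfl
        | some d =>
          rw [visibleTrace_singleton, h]
          refine .lift ?_
          rw [eventEquiv_iff_visible_eq, ← Event.visible_bind_visible (subset_refl Lo) c, h]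
          rfl
      have := TraceEquiv.append hc ih
      rwa [← visibleTrace_append] at this
  constructor
  · intro h
    induction h with
    | lift h => simp [visibleTrace_singleton, eventEquiv_iff_visible_eq.1 h]
    | bulletR t => simp [visibleTrace_append, visibleTrace_bullet]
    | bulletL t => rfl
    | refl => rfl
    | symm _ ih => exact ih.symm
    | trans _ _ ih₁ ih₂ => exact ih₁.trans ih₂
    | append _ _ ih₁ ih₂ => rw [visibleTrace_append, visibleTrace_append, ih₁, ih₂]
  · intro h
    exact .trans (key t) (h ▸ .symm (key t'))

/-! ## High labels -/

namespace Authority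

theorem ActsFor.refl (a : Authority D) : a.ActsFor a := by
  obtain ⟨p⟩ := a
  exact Form.ActsFor.refl p

theorem ActsFor.trans {a b c : Authority D} (h : a.ActsFor b) (k : b.ActsFor c) :
    a.ActsFor c := by
  obtain ⟨p⟩ := a
  obtain ⟨q⟩ := b
  obtain ⟨r⟩ := c
  exact Form.ActsFor.trans h k

theorem actsFor_bot (a : Authority D) : a.ActsFor .bot := by
  obtain ⟨p⟩ := a
  exact Form.ActsFor.bot p

theorem conj_actsFor_left (a b : Authority D) : (a.conj b).ActsFor a := by
  obtain ⟨p⟩ := a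
  obtain ⟨q⟩ := b
  exact Form.ActsFor.conjL₁ (.refl p)

theorem conj_actsFor_right (a b : Authority D) : (a.conj b).ActsFor b := by
  obtain ⟨p⟩ := a
  obtain ⟨q⟩ := b
  exact Form.ActsFor.conjL₂ (.refl q)

theorem actsFor_conj {a b c : Authority D} (h : a.ActsFor b) (k : a.ActsFor c) :
    a.ActsFor (b.conj c) := by
  obtain ⟨p⟩ := a
  obtain ⟨q⟩ := b
  obtain ⟨r⟩ := c
  exact Form.ActsFor.conjR h k

theorem actsFor_disj_left (a b : Authority D) : a.ActsFor (a.disj b) := by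
  obtain ⟨p⟩ := a
  obtain ⟨q⟩ := b
  exact Form.ActsFor.disjR₁ (.refl p)

end Authority

theorem Label.flowsTo_join_left (l m : Label D) : l.FlowsTo (l.join m) :=
  ⟨Authority.conj_actsFor_left _ _, Authority.actsFor_disj_left _ _⟩

theorem Label.flowsTo_join_right (l m : Label D) : m.FlowsTo (l.join m) := by
  refine ⟨Authority.conj_actsFor_right _ _, ?_⟩
  obtain ⟨a, ⟨p⟩⟩ := l
  obtain ⟨b, ⟨q⟩⟩ := m
  exact Form.ActsFor.disjR₂ (.refl q)

/-- Information does not flow from outside `Lo` into `Lo`. -/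
def FlowClosed (Lo : Set (Label D)) : Prop := ∀ l m : Label D, l.FlowsTo m → l ∉ Lo → m ∉ Lo

theorem flowClosed_trusted {A : Set (Label D)} (hA : IsAttacker A) : FlowClosed (trusted A) := by
  intro l m h hl
  rw [trusted, Set.notMem_compl_iff] at hl ⊢
  exact hA.closed _ hl _ ⟨.refl _, h.2⟩

theorem flowClosed_public {A : Set (Label D)} (hA : IsAttacker A) : FlowClosed (secret A)ᶜ := by
  intro l m h hl
  rw [Set.notMem_compl_iff] at hl ⊢
  exact fun hm => hl (hA.closed _ hm _ ⟨h.1, .refl _⟩)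

/-- Only public data can be endorsed across the trust boundary. -/
theorem public_of_endorse {A : Set (Label D)} (hA : IsAttacker A) {l' l pc : Label D}
    (hc : l'.proj .conf = l.proj .conf)
    (hf : (l'.proj .integ).FlowsTo ((l.proj .integ).join ((l'.join pc).proj .conf).voice))
    (hl' : l' ∉ trusted A) (hl : l ∈ trusted A) : l ∈ lowSet A := by
  refine ⟨hl, ?_⟩
  rw [trusted, Set.notMem_compl_iff] at hl'
  -- The premise `hf` says that the integrity of `l'` acts for `l.integ ∨ (l'.conf ∧ pc.conf)`; `m`
  -- carries the second disjunct as integrity.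
  let m : Label D := ⟨.bot, l'.conf.conj pc.conf⟩
  have h₁ : l.disj m ∈ aspectOf A .integ := by
    refine ⟨.bot, hA.closed _ hl' _ ⟨?_, ?_⟩⟩
    · exact Authority.actsFor_conj (.refl _) (.refl _)
    · exact Authority.actsFor_conj hf.2 (Authority.actsFor_bot _)
  have h₂ : l ∉ aspectOf A .integ := by
    rintro ⟨q, hq⟩
    exact hl (hA.closed _ hq _ ⟨Authority.actsFor_bot _, Authority.conj_actsFor_left _ _⟩)
  -- Primeness of the attacker: it has the disjunction but not the integrity of `l`, so it has the
  -- other disjunct.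
  have h₃ : m ∈ aspectOf A .integ := by
    by_contra h
    exact hA.disj_not_mem _ _ h₂ _ h h₁
  obtain ⟨q, hq⟩ := h₃
  have h₄ : (⟨.bot, l'.conf⟩ : Label D) ∈ A :=
    hA.closed _ hq _ ⟨Authority.actsFor_bot _,
      (Authority.conj_actsFor_left _ _).trans (Authority.conj_actsFor_left _ _)⟩
  -- Equal power in both aspects turns the confidentiality of `l'`, held as integrity, into the
  -- ability to read it.
  have h₅ : l'.proj .conf ∈ A :=
    hA.closed _ (hA.voice_view _ h₄) _
      ⟨Authority.conj_actsFor_right .bot l'.conf, Authority.actsFor_bot _⟩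
  rw [hc] at h₅
  exact fun h => h h₅

/-! ## Big-step semantics -/

/-- `Big e u t`: the expression `e` evaluates to the value `u` and emits the events `t`. -/
inductive Big : Tm D → Tm D → Trace D → Prop where
  | unit : Big .unit .unit []
  | lam {τ : Ty D} {pc : Label D} {e : Tm D} : Big (.lam τ pc e) (.lam τ pc e) []
  | tlam {pc : Label D} {e : Tm D} : Big (.tlam pc e) (.tlam pc e) []
  | vret {l : Label D} {τ : Ty D} {v : Tm D} : v.IsValue → Big (.vret l τ v) (.vret l τ v) []
  | app {e₁ e₂ b v u : Tm D} {τ : Ty D} {pc : Label D} {t₁ t₂ t₃ : Trace D} :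
      Big e₁ (.lam τ pc b) t₁ → Big e₂ v t₂ → Big (b.inst v) u t₃ →
      Big (.app e₁ e₂) u (t₁ ++ (t₂ ++ .bullet :: t₃))
  | tapp {e b u : Tm D} {τ : Ty D} {pc : Label D} {t₁ t₂ : Trace D} :
      Big e (.tlam pc b) t₁ → Big (b.tsubst (Ty.single τ)) u t₂ →
      Big (.tapp e τ) u (t₁ ++ .bullet :: t₂)
  | pair {e₁ e₂ v₁ v₂ : Tm D} {t₁ t₂ : Trace D} : Big e₁ v₁ t₁ → Big e₂ v₂ t₂ →
      Big (.pair e₁ e₂) (.pair v₁ v₂) (t₁ ++ t₂)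
  | proj {i : Bool} {e v₁ v₂ : Tm D} {t : Trace D} : Big e (.pair v₁ v₂) t →
      Big (.proj i e) (bif i then v₂ else v₁) (t ++ [.bullet])
  | inj {i : Bool} {τ₁ τ₂ : Ty D} {e v : Tm D} {t : Trace D} : Big e v t →
      Big (.inj i τ₁ τ₂ e) (.inj i τ₁ τ₂ v) t
  | case {i : Bool} {τ₁ τ₂ : Ty D} {e e₁ e₂ v u : Tm D} {t₁ t₂ : Trace D} :
      Big e (.inj i τ₁ τ₂ v) t₁ → Big ((bif i then e₂ else e₁).inst v) u t₂ →
      Big (.case e e₁ e₂) u (t₁ ++ .bullet :: t₂)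
  | ret {l : Label D} {τ : Ty D} {e v : Tm D} {t : Trace D} : Big e v t →
      Big (.ret l τ e) (.vret l τ v) (t ++ [.val (.vret l τ v)])
  | bind {l : Label D} {τ : Ty D} {e e' v u : Tm D} {t₁ t₂ : Trace D} :
      Big e (.vret l τ v) t₁ → Big (e'.inst v) u t₂ →
      Big (.bind e e') u (t₁ ++ .bullet :: t₂)
  | decl {l' l : Label D} {τ : Ty D} {e v : Tm D} {t : Trace D} : Big e (.vret l' τ v) t →
      Big (.decl e l) (.vret l τ v) (t ++ [.down .conf l' l τ v])
  | endorse {l' l : Label D} {τ : Ty D} {e v : Tm D} {t : Trace D} : Big e (.vret l' τ v) t →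
      Big (.endorse e l) (.vret l τ v) (t ++ [.down .integ l' l τ v])

theorem Tm.IsValue.big {v : Tm D} (h : v.IsValue) : Big v v [] := by
  induction h with
  | unit => exact .unit
  | inj _ ih => exact .inj ih
  | pair _ _ ih₁ ih₂ => exact .pair ih₁ ih₂
  | vret h _ => exact .vret h
  | lam => exact .lam
  | tlam => exact .tlam

theorem Tm.IsValue.eq_of_big {v u : Tm D} {t : Trace D} (h : v.IsValue) (hb : Big v u t) :
    u = v ∧ t = [] := by
  induction h generalizing u t with
  | inj _ ih => cases hb with | inj hb => simp [ih hb]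
  | pair _ _ ih₁ ih₂ => cases hb with | pair h₁ h₂ => simp [ih₁ h₁, ih₂ h₂]
  | _ => cases hb; exact ⟨rfl, rfl⟩

theorem Big.isValue {e u : Tm D} {t : Trace D} (h : Big e u t) : u.IsValue := by
  induction h with
  | unit => exact .unit
  | lam => exact .lam
  | tlam => exact .tlam
  | vret h => exact .vret h
  | app _ _ _ _ _ ih => exact ih
  | tapp _ _ _ ih => exact ih
  | pair _ _ ih₁ ih₂ => exact .pair ih₁ ih₂
  | @proj i _ _ _ _ _ ih =>
    cases ih
    cases i <;> assumption
  | inj _ ih => exact .inj ih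
  | case _ _ _ ih => exact ih
  | ret _ ih => exact .vret ih
  | bind _ _ _ ih => exact ih
  | decl _ ih | endorse _ ih =>
    cases ih
    exact .vret ‹_›

/-- Head expansion passes through evaluation contexts because the hole is what is evaluated next, so
its event heads the whole trace. -/
theorem Big.fill {e e' : Tm D} {c : Event D}
    (h : ∀ u t, Big e' u t → Big e u (c :: t)) (E : ECtx D) {u : Tm D} {t : Trace D}
    (hb : Big (E.fill e') u t) : Big (E.fill e) u (c :: t) := by
  induction E generalizing u t with
  | hole => exact h _ _ hb
  | appL E a ih => cases hb with | app h₁ h₂ h₃ => exact .app (ih h₁) h₂ h₃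
  | appR v hv E ih =>
    cases hb with
    | app h₁ h₂ h₃ =>
      -- The operand to the left is already a value and emits nothing, so `c` still comes first.
      obtain ⟨rfl, rfl⟩ := hv.eq_of_big h₁
      exact .app h₁ (ih h₂) h₃
  | tapp E τ ih => cases hb with | tapp h₁ h₂ => exact .tapp (ih h₁) h₂
  | pairL E a ih => cases hb with | pair h₁ h₂ => exact .pair (ih h₁) h₂
  | pairR v hv E ih =>
    cases hb with
    | pair h₁ h₂ =>
      obtain ⟨rfl, rfl⟩ := hv.eq_of_big h₁
      exact .pair h₁ (ih h₂)
  | ret l τ E ih => cases hb with | ret h₁ => exact .ret (ih h₁)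
  | proj i E ih => cases hb with | proj h₁ => exact .proj (ih h₁)
  | inj i τ₁ τ₂ E ih => cases hb with | inj h₁ => exact .inj (ih h₁)
  | bind E a ih => cases hb with | bind h₁ h₂ => exact .bind (ih h₁) h₂
  | case E a b ih => cases hb with | case h₁ h₂ => exact .case (ih h₁) h₂
  | decl E l ih => cases hb with | decl h₁ => exact .decl (ih h₁)
  | endorse E l ih => cases hb with | endorse h₁ => exact .endorse (ih h₁)

theorem Step.big {p q : Tm D × Trace D} (h : Step p q) :
    ∃ c, q.2 = p.2 ++ [c] ∧ ∀ u t, Big q.1 u t → Big p.1 u (c :: t) := by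
  induction h with
  | red h =>
    refine ⟨.bullet, rfl, fun u t hb => ?_⟩
    cases h with
    | app hv => exact .app .lam hv.big hb
    | tapp => exact .tapp .tlam hb
    | @proj i v₁ v₂ hv₁ hv₂ =>
      have hv : (bif i then v₂ else v₁).IsValue := by cases i <;> assumption
      obtain ⟨rfl, rfl⟩ := hv.eq_of_big hb
      exact .proj (.pair hv₁.big hv₂.big)
    | case hv => exact .case (.inj hv.big) hb
    | bind hv => exact .bind (.vret hv) hb
  | unitM hv =>
    refine ⟨_, rfl, fun u t hb => ?_⟩
    obtain ⟨rfl, rfl⟩ := (Tm.IsValue.vret hv).eq_of_big hb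
    exact .ret hv.big
  | decl hv =>
    refine ⟨_, rfl, fun u t hb => ?_⟩
    obtain ⟨rfl, rfl⟩ := (Tm.IsValue.vret hv).eq_of_big hb
    exact .decl (.vret hv)
  | endorse hv =>
    refine ⟨_, rfl, fun u t hb => ?_⟩
    obtain ⟨rfl, rfl⟩ := (Tm.IsValue.vret hv).eq_of_big hb
    exact .endorse (.vret hv)
  | eval E _ ih =>
    obtain ⟨c, hc, h⟩ := ih
    exact ⟨c, hc, fun u t hb => Big.fill h E hb⟩

/-- Induction from the value backwards, each step prepending its one event by `Step.big`. -/
theorem Big.of_steps {p q : Tm D × Trace D} (h : Relation.ReflTransGen Step p q)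
    (hq : q.1.IsValue) : ∃ s, q.2 = p.2 ++ s ∧ Big p.1 q.1 s := by
  induction h using Relation.ReflTransGen.head_induction_on with
  | refl => exact ⟨[], by simp, hq.big⟩
  | head hs _ ih =>
    obtain ⟨s, hs', hb⟩ := ih
    obtain ⟨c, hc, h⟩ := hs.big
    exact ⟨c :: s, by simp [hs', hc], h _ _ hb⟩

theorem Runs.big {e v w : Tm D} {t : Trace D} (h : Runs e v w t) :
    ∃ u s, t = .val v :: .val w :: s ∧ Big (e.inst₂ v w) u s := by
  obtain ⟨u, hu, h⟩ := h
  obtain ⟨s, hs, hb⟩ := Big.of_steps h hu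
  exact ⟨u, s, hs, hb⟩

/-- Evaluation preserves types; at a high program counter all its events are invisible. -/
theorem Big.preservation {Lo : Set (Label D)} (hLo : FlowClosed Lo) {n : ℕ} {Γ : List (Ty D)}
    {pc : Label D} {e u : Tm D} {τ : Ty D} {t : Trace D} (hb : Big e u t)
    (h : HasType n Γ pc e τ) :
    HasType n Γ pc u τ ∧ (pc ∉ Lo → visibleTrace Lo t = []) := by
  induction hb generalizing pc τ with
  | unit | lam | tlam | vret => exact ⟨h, fun _ => rfl⟩
  | app hb₁ hb₂ hb₃ ih₁ ih₂ ih₃ =>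
    cases h with
    | app h₁ h₂ hf =>
      obtain ⟨k₁, s₁⟩ := ih₁ h₁
      obtain ⟨k₂, s₂⟩ := ih₂ h₂
      cases k₁ with
      | lam k₁ =>
        obtain ⟨k₃, s₃⟩ := ih₃ (k₁.inst hb₂.isValue k₂)
        refine ⟨k₃.value_pc hb₃.isValue _, fun hpc => ?_⟩
        -- The body runs at a label to which the hidden `pc` flows, so it is silent as well.
        have := s₃ (hLo _ _ hf hpc)
        simp_all [visibleTrace, Event.visible]
  | tapp hb₁ hb₂ ih₁ ih₂ =>
    cases h with
    | tapp h₁ hf hw =>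
      obtain ⟨k₁, s₁⟩ := ih₁ h₁
      cases k₁ with
      | tlam k₁ =>
        obtain ⟨k₂, s₂⟩ := ih₂ (k₁.tsubst_single hw)
        refine ⟨k₂.value_pc hb₂.isValue _, fun hpc => ?_⟩
        have := s₂ (hLo _ _ hf hpc)
        simp_all [visibleTrace, Event.visible]
  | pair _ _ ih₁ ih₂ =>
    cases h with
    | pair h₁ h₂ =>
      obtain ⟨k₁, s₁⟩ := ih₁ h₁
      obtain ⟨k₂, s₂⟩ := ih₂ h₂
      refine ⟨.pair k₁ k₂, fun hpc => ?_⟩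
      simp [visibleTrace_append, s₁ hpc, s₂ hpc]
  | @proj i _ _ _ _ _ ih =>
    cases h with
    | proj h =>
      obtain ⟨k, s⟩ := ih h
      cases k with
      | pair k₁ k₂ =>
        refine ⟨by cases i <;> assumption, fun hpc => ?_⟩
        simp [visibleTrace_append, s hpc, visibleTrace_bullet]
  | inj _ ih =>
    cases h with
    | inj h =>
      obtain ⟨k, s⟩ := ih h
      exact ⟨.inj k, s⟩
  | @case i _ _ _ e₁ e₂ v _ _ _ hb₁ hb₂ ih₁ ih₂ =>
    cases h with
    | case h hp h₁ h₂ =>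
      obtain ⟨k₁, s₁⟩ := ih₁ h
      have hv := hb₁.isValue
      cases hv with
      | inj hv =>
      cases k₁ with
      | inj k₁ =>
        have hbr : HasType n Γ pc ((bif i then e₂ else e₁).inst v) τ := by
          cases i
          · exact h₁.inst hv k₁
          · exact h₂.inst hv k₁
        obtain ⟨k₂, s₂⟩ := ih₂ hbr
        refine ⟨k₂, fun hpc => ?_⟩
        have := s₂ hpc
        simp_all [visibleTrace, Event.visible]
  | ret hb ih =>
    cases h with
    | unitM h hf =>
      obtain ⟨k, s⟩ := ih h
      refine ⟨.vunitM hb.isValue k, fun hpc => ?_⟩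
      rw [visibleTrace_append, s hpc, visibleTrace_singleton,
        Event.visible_val_hidden (hLo _ _ hf hpc)]
      rfl
  | bind hb₁ hb₂ ih₁ ih₂ =>
    cases h with
    | bindM h hp h' =>
      obtain ⟨k₁, s₁⟩ := ih₁ h
      cases k₁ with
      | vunitM hv k₁ =>
        obtain ⟨k₂, s₂⟩ := ih₂ (h'.inst hv k₁)
        refine ⟨k₂.value_pc hb₂.isValue _, fun hpc => ?_⟩
        have := s₂ (hLo _ _ (Label.flowsTo_join_left _ _) hpc)
        simp_all [visibleTrace, Event.visible]
  | decl _ ih =>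
    cases h with
    | decl h _ hf _ =>
      obtain ⟨k, s⟩ := ih h
      cases k with
      | vunitM hv k =>
        refine ⟨.vunitM hv k, fun hpc => ?_⟩
        rw [visibleTrace_append, s hpc, visibleTrace_singleton,
          Event.visible_down_not_mem (hLo _ _ hf hpc)]
        rfl
  | endorse _ ih =>
    cases h with
    | endorse h _ hf _ =>
      obtain ⟨k, s⟩ := ih h
      cases k with
      | vunitM hv k =>
        refine ⟨.vunitM hv k, fun hpc => ?_⟩
        rw [visibleTrace_append, s hpc, visibleTrace_singleton,
          Event.visible_down_not_mem (hLo _ _ hf hpc)]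
        rfl

/-- All values of a high type look the same, and no `decl` in them is visible. -/
theorem Protects.erase_eq {Lo : Set (Label D)} (hLo : FlowClosed Lo) {n : ℕ} {Γ : List (Ty D)}
    {h pc pc' : Label D} {v v' : Tm D} {τ : Ty D} (hp : Protects h τ) (hh : h ∉ Lo)
    (hv : v.IsValue) (hv' : v'.IsValue) (ht : HasType n Γ pc v τ) (ht' : HasType n Γ pc' v' τ) :
    v.erase Lo = v'.erase Lo ∧ (v.erase Lo).DeclFree := by
  induction hp generalizing v v' with
  | unit =>
    cases hv <;> cases ht
    cases hv' <;> cases ht'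
    exact ⟨rfl, trivial⟩
  | lbl hf =>
    -- The protecting label is itself hidden, so the whole content, including any `decl` in it,
    -- disappears into the mark of the common type.
    have hl := hLo _ _ hf hh
    cases hv <;> cases ht
    cases hv' <;> cases ht'
    rw [Tm.erase_vret_not_mem hl, Tm.erase_vret_not_mem hl]
    exact ⟨rfl, trivial⟩
  | pair _ _ ih₁ ih₂ =>
    cases hv <;> cases ht
    rename_i k₁ k₂
    cases hv' <;> cases ht'
    rename_i k₁' k₂'
    obtain ⟨h₁, d₁⟩ := ih₁ ‹_› ‹_› k₁ k₁'
    obtain ⟨h₂, d₂⟩ := ih₂ ‹_› ‹_› k₂ k₂'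
    exact ⟨by rw [Tm.erase, Tm.erase, h₁, h₂], d₁, d₂⟩

/-! ## Two runs -/

/-- The traces look the same up to downgrades to the same label in `Q` of values that look
different. -/
def Diverge (Lo Q : Set (Label D)) (s t : Trace D) : Prop :=
  ∃ (a b a' b' : Trace D) (π : Aspect) (l' l : Label D) (τ : Ty D) (v v' : Tm D),
    s = a ++ .down π l' l τ v :: b ∧ t = a' ++ .down π l' l τ v' :: b' ∧
    visibleTrace Lo a = visibleTrace Lo a' ∧ l ∈ Lo ∧ l ∈ Q ∧ v.erase Lo ≠ v'.erase Lo

/-- Nothing is claimed after the divergence, so unrelated tails may follow; the simulation can stop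
at the first diverging subevaluation. -/
theorem Diverge.append {Lo Q : Set (Label D)} {s t : Trace D} (h : Diverge Lo Q s t)
    (s' t' : Trace D) : Diverge Lo Q (s ++ s') (t ++ t') := by
  obtain ⟨a, b, a', b', π, l', l, τ, v, v', rfl, rfl, h⟩ := h
  exact ⟨a, b ++ s', a', b' ++ t', π, l', l, τ, v, v', by simp, by simp, h⟩

theorem Diverge.prepend {Lo Q : Set (Label D)} {s t s' t' : Trace D}
    (hs : visibleTrace Lo s' = visibleTrace Lo t') (h : Diverge Lo Q s t) :
    Diverge Lo Q (s' ++ s) (t' ++ t) := by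
  obtain ⟨a, b, a', b', π, l', l, τ, v, v', rfl, rfl, ha, h⟩ := h
  exact ⟨s' ++ a, b, t' ++ a', b', π, l', l, τ, v, v', by simp, by simp,
    by rw [visibleTrace_append, visibleTrace_append, hs, ha], h⟩

theorem Diverge.cons_bullet {Lo Q : Set (Label D)} {s t : Trace D} (h : Diverge Lo Q s t) :
    Diverge Lo Q (.bullet :: s) (.bullet :: t) :=
  h.prepend (s' := [.bullet]) (t' := [.bullet]) rfl

/-- Two runs yield results and traces that look the same (where, if `F` holds, no `decl` is
visible in the results), or their traces diverge. -/
def Agree (F : Prop) (Lo Q : Set (Label D)) (u : Tm D) (s : Trace D) (u' : Tm D)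
    (t : Trace D) : Prop :=
  (u.erase Lo = u'.erase Lo ∧ visibleTrace Lo s = visibleTrace Lo t ∧
    (F → (u.erase Lo).DeclFree)) ∨ Diverge Lo Q s t

section Agree

variable {F : Prop} {Lo Q : Set (Label D)} {u u' : Tm D} {s t : Trace D}

theorem Agree.prepend {s' t' : Trace D} (hs : visibleTrace Lo s' = visibleTrace Lo t')
    (h : Agree F Lo Q u s u' t) : Agree F Lo Q u (s' ++ s) u' (t' ++ t) := by
  rcases h with ⟨hu, ht, hd⟩ | h
  · exact .inl ⟨hu, by rw [visibleTrace_append, visibleTrace_append, hs, ht], hd⟩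
  · exact .inr (h.prepend hs)

theorem Agree.cons_bullet (h : Agree F Lo Q u s u' t) :
    Agree F Lo Q u (.bullet :: s) u' (.bullet :: t) :=
  h.prepend (s' := [.bullet]) (t' := [.bullet]) rfl

/-- A hidden target makes the events and results invisible, and a visible source already forces
equal payloads. Only a hidden source with a visible target can reveal a difference: `hQ` places that
target in `Q`, and `hF` excludes the case when `F` holds. -/
theorem Agree.down {l' l : Label D} {τ : Ty D} {v v' : Tm D} (π : Aspect)
    (hQ : l' ∉ Lo → l ∈ Lo → l ∈ Q) (hF : F → l' ∉ Lo → l ∉ Lo)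
    (hv : (Tm.vret l' τ v).erase Lo = (Tm.vret l' τ v').erase Lo)
    (hs : visibleTrace Lo s = visibleTrace Lo t)
    (hd : F → ((Tm.vret l' τ v).erase Lo).DeclFree) :
    Agree F Lo Q (.vret l τ v) (s ++ [.down π l' l τ v]) (.vret l τ v')
      (t ++ [.down π l' l τ v']) := by
  by_cases hl : l ∈ Lo
  · rw [Agree, Tm.erase_vret_mem hl, Tm.erase_vret_mem hl]
    by_cases hl' : l' ∈ Lo
    · rw [Tm.erase_vret_mem hl', Tm.erase_vret_mem hl'] at hv
      rw [Tm.erase_vret_mem hl'] at hd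
      have hv := (Tm.vret.inj hv).2.2
      refine .inl ⟨by rw [hv], ?_, hd⟩
      rw [visibleTrace_append, visibleTrace_append, hs, visibleTrace_singleton,
        visibleTrace_singleton, Event.visible_down_mem hl, Event.visible_down_mem hl, hv]
    · by_cases hv : v.erase Lo = v'.erase Lo
      · refine .inl ⟨by rw [hv], ?_, fun hf => absurd hl (hF hf hl')⟩
        rw [visibleTrace_append, visibleTrace_append, hs, visibleTrace_singleton,
          visibleTrace_singleton, Event.visible_down_mem hl, Event.visible_down_mem hl, hv]
      · exact .inr ⟨s, [], t, [], π, l', l, τ, v, v', rfl, rfl, hs, hl, hQ hl' hl, hv⟩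
  · rw [Agree, Tm.erase_vret_not_mem hl, Tm.erase_vret_not_mem hl]
    refine .inl ⟨rfl, ?_, fun _ => trivial⟩
    rw [visibleTrace_append, visibleTrace_append, hs, visibleTrace_singleton,
      visibleTrace_singleton, Event.visible_down_not_mem hl, Event.visible_down_not_mem hl]

end Agree

/-- Runs of low-equivalent expressions agree, provided that every downgrade from an invisible to
a visible label has its target in `Q`. -/
theorem Big.simulation {F : Prop} {Lo Q : Set (Label D)} (hLo : FlowClosed Lo)
    (hdecl : ¬ F → ∀ l' l : Label D, l'.proj .integ = l.proj .integ →
      l' ∉ Lo → l ∈ Lo → l ∈ Q)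
    (hend : ∀ l' l pc : Label D, l'.proj .conf = l.proj .conf →
      (l'.proj .integ).FlowsTo ((l.proj .integ).join ((l'.join pc).proj .conf).voice) →
      l' ∉ Lo → l ∈ Lo → ¬ F ∧ l ∈ Q)
    {n : ℕ} {Γ : List (Ty D)} {pc : Label D} {e u e' u' : Tm D} {τ : Ty D} {s t : Trace D}
    (hb : Big e u s) (hb' : Big e' u' t) (h : HasType n Γ pc e τ) (h' : HasType n Γ pc e' τ)
    (he : e.erase Lo = e'.erase Lo) (hd : F → (e.erase Lo).DeclFree) :
    Agree F Lo Q u s u' t := by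
  induction hb generalizing pc e' u' τ t with
  | unit =>
    cases e' with
    | unit => cases hb'; exact .inl ⟨rfl, rfl, hd⟩
    | vret => simp only [Tm.erase] at he; split at he <;> cases he
    | _ => simp only [Tm.erase, reduceCtorEq] at he
  | lam =>
    cases e' with
    | lam => cases hb'; exact .inl ⟨he, rfl, hd⟩
    | vret => simp only [Tm.erase] at he; split at he <;> cases he
    | _ => simp only [Tm.erase, reduceCtorEq] at he
  | tlam =>
    cases e' with
    | tlam => cases hb'; exact .inl ⟨he, rfl, hd⟩
    | vret => simp only [Tm.erase] at he; split at he <;> cases he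
    | _ => simp only [Tm.erase, reduceCtorEq] at he
  | vret =>
    cases e' with
    | vret => cases hb'; exact .inl ⟨he, rfl, hd⟩
    | bullet => cases hb'
    | _ => simp only [Tm.erase] at he; split at he <;> cases he
  | app hb₁ hb₂ hb₃ ih₁ ih₂ ih₃ =>
    cases e' with
    | app e₁' e₂' =>
      rw [Tm.erase, Tm.erase, Tm.app.injEq] at he
      cases hb' with | app hb₁' hb₂' hb₃' => ?_
      cases h with | app h₁ h₂ hf => ?_
      cases h' with | app h₁' h₂' hf' => ?_
      -- Equal erasures force equal function types, so the arguments have a common type and the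
      -- induction hypotheses apply to them.
      cases h₁.unique h₁' he.1
      rcases ih₁ hb₁' h₁ h₁' he.1 fun hF => (hd hF).1 with ⟨hu₁, ht₁, hd₁⟩ | h
      · rcases ih₂ hb₂' h₂ h₂' he.2 fun hF => (hd hF).2 with ⟨hu₂, ht₂, hd₂⟩ | h
        · refine .prepend ht₁ (.prepend ht₂ (.cons_bullet ?_))
          cases (hb₁.preservation hLo h₁).1 with | lam k₁ => ?_
          cases (hb₁'.preservation hLo h₁').1 with | lam k₁' => ?_
          rw [Tm.erase, Tm.erase, Tm.lam.injEq] at hu₁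
          refine ih₃ hb₃' (k₁.inst hb₂.isValue (hb₂.preservation hLo h₂).1)
            (k₁'.inst hb₂'.isValue (hb₂'.preservation hLo h₂').1) ?_ fun hF => ?_
          · rw [Tm.erase_inst, Tm.erase_inst, hu₁.2.2, hu₂]
          · rw [Tm.erase_inst]
            exact Tm.DeclFree.inst (hd₁ hF) (hd₂ hF)
        · exact .inr (.prepend ht₁ (h.append _ _))
      · exact .inr (h.append _ _)
    | vret => simp only [Tm.erase] at he; split at he <;> cases he
    | _ => simp only [Tm.erase, reduceCtorEq] at he
  | tapp hb₁ hb₂ ih₁ ih₂ =>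
    cases e' with
    | tapp e₁' σ =>
      rw [Tm.erase, Tm.erase, Tm.tapp.injEq] at he
      obtain ⟨he, rfl⟩ := he
      cases hb' with | tapp hb₁' hb₂' => ?_
      -- The rule makes the type a substitution instance; a separate name keeps the type index of
      -- `h'` a variable, so that it can be inverted too.
      generalize hτ : τ = τ₀ at h'
      cases h with | tapp h₁ hf hw => ?_
      cases h' with | tapp h₁' hf' hw' => ?_
      cases h₁.unique h₁' he
      rcases ih₁ hb₁' h₁ h₁' he hd with ⟨hu₁, ht₁, hd₁⟩ | h
      · refine .prepend ht₁ (.cons_bullet ?_)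
        cases (hb₁.preservation hLo h₁).1 with | tlam k₁ => ?_
        cases (hb₁'.preservation hLo h₁').1 with | tlam k₁' => ?_
        rw [Tm.erase, Tm.erase, Tm.tlam.injEq] at hu₁
        refine ih₂ hb₂' (k₁.tsubst_single hw) (k₁'.tsubst_single hw) ?_ fun hF => ?_
        · rw [Tm.erase_tsubst, Tm.erase_tsubst, hu₁.2]
        · rw [Tm.erase_tsubst]
          refine Tm.DeclFree.tsubst ?_ _
          exact hd₁ hF
      · exact .inr (h.append _ _)
    | vret => simp only [Tm.erase] at he; split at he <;> cases he
    | _ => simp only [Tm.erase, reduceCtorEq] at he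
  | pair hb₁ hb₂ ih₁ ih₂ =>
    cases e' with
    | pair e₁' e₂' =>
      rw [Tm.erase, Tm.erase, Tm.pair.injEq] at he
      cases hb' with | pair hb₁' hb₂' => ?_
      cases h with | pair h₁ h₂ => ?_
      cases h' with | pair h₁' h₂' => ?_
      rcases ih₁ hb₁' h₁ h₁' he.1 fun hF => (hd hF).1 with ⟨hu₁, ht₁, hd₁⟩ | h
      · rcases ih₂ hb₂' h₂ h₂' he.2 fun hF => (hd hF).2 with ⟨hu₂, ht₂, hd₂⟩ | h
        · refine .inl ⟨by rw [Tm.erase, Tm.erase, hu₁, hu₂], ?_, fun hF => ⟨hd₁ hF, hd₂ hF⟩⟩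
          rw [visibleTrace_append, visibleTrace_append, ht₁, ht₂]
        · exact .inr (.prepend ht₁ h)
      · exact .inr (h.append _ _)
    | vret => simp only [Tm.erase] at he; split at he <;> cases he
    | _ => simp only [Tm.erase, reduceCtorEq] at he
  | @proj i _ _ _ _ hb ih =>
    cases e' with
    | proj i' e' =>
      rw [Tm.erase, Tm.erase, Tm.proj.injEq] at he
      obtain ⟨rfl, he⟩ := he
      cases hb' with | proj hb' => ?_
      generalize hτ : τ = τ₀ at h'
      cases h with | proj h => ?_
      cases h' with | proj h' => ?_
      cases h.unique h' he
      rcases ih hb' h h' he hd with ⟨hu, ht, hd'⟩ | h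
      · rw [Tm.erase, Tm.erase, Tm.pair.injEq] at hu
        refine .inl ⟨?_, by rw [visibleTrace_append, visibleTrace_append, ht], fun hF => ?_⟩
        · cases i
          · exact hu.1
          · exact hu.2
        · cases i
          · exact (hd' hF).1
          · exact (hd' hF).2
      · exact .inr (h.append _ _)
    | vret => simp only [Tm.erase] at he; split at he <;> cases he
    | _ => simp only [Tm.erase, reduceCtorEq] at he
  | inj hb ih =>
    cases e' with
    | inj i' σ₁ σ₂ e' =>
      rw [Tm.erase, Tm.erase, Tm.inj.injEq] at he
      obtain ⟨rfl, rfl, rfl, he⟩ := he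
      cases hb' with | inj hb' => ?_
      cases h with | inj h => ?_
      cases h' with | inj h' => ?_
      rcases ih hb' h h' he hd with ⟨hu, ht, hd⟩ | h
      · exact .inl ⟨by rw [Tm.erase, Tm.erase, hu], ht, hd⟩
      · exact .inr h
    | vret => simp only [Tm.erase] at he; split at he <;> cases he
    | _ => simp only [Tm.erase, reduceCtorEq] at he
  | @case i _ _ _ e₁ e₂ v _ _ _ hb₁ hb₂ ih₁ ih₂ =>
    cases e' with
    | case e' e₁' e₂' =>
      rw [Tm.erase, Tm.erase, Tm.case.injEq] at he
      obtain ⟨he, he₁, he₂⟩ := he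
      cases hb' with | @case i' _ _ _ _ _ v' _ _ _ hb₁' hb₂' => ?_
      cases h with | case h hp h₁ h₂ => ?_
      cases h' with | case h' hp' h₁' h₂' => ?_
      cases h.unique h' he
      rcases ih₁ hb₁' h h' he fun hF => (hd hF).1 with ⟨hu, ht, hd'⟩ | h
      · refine .prepend ht (.cons_bullet ?_)
        rw [Tm.erase, Tm.erase, Tm.inj.injEq] at hu
        -- Erasure never hides an injection, so both runs take the same branch.
        obtain ⟨rfl, rfl, rfl, hu⟩ := hu
        cases (hb₁.preservation hLo h).1 with | inj k => ?_
        cases (hb₁'.preservation hLo h').1 with | inj k' => ?_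
        cases hb₁.isValue with | inj hv => ?_
        cases hb₁'.isValue with | inj hv' => ?_
        cases i
        · refine ih₂ hb₂' (h₁.inst hv k) (h₁'.inst hv' k') ?_ fun hF => ?_
          · rw [cond_false, cond_false, Tm.erase_inst, Tm.erase_inst, he₁, hu]
          · rw [cond_false, Tm.erase_inst]
            exact Tm.DeclFree.inst (hd hF).2.1 (hd' hF)
        · refine ih₂ hb₂' (h₂.inst hv k) (h₂'.inst hv' k') ?_ fun hF => ?_
          · rw [cond_true, cond_true, Tm.erase_inst, Tm.erase_inst, he₂, hu]
          · rw [cond_true, Tm.erase_inst]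
            exact Tm.DeclFree.inst (hd hF).2.2 (hd' hF)
      · exact .inr (h.append _ _)
    | vret => simp only [Tm.erase] at he; split at he <;> cases he
    | _ => simp only [Tm.erase, reduceCtorEq] at he
  | @ret l σ _ v _ hb ih =>
    cases e' with
    | ret l' σ' e' =>
      rw [Tm.erase, Tm.erase, Tm.ret.injEq] at he
      obtain ⟨rfl, rfl, he⟩ := he
      cases hb' with | @ret _ _ _ v' _ hb' => ?_
      cases h with | unitM h _ => ?_
      cases h' with | unitM h' _ => ?_
      rcases ih hb' h h' he hd with ⟨hu, ht, hd⟩ | h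
      · have hv : (Tm.vret l σ v).erase Lo = (Tm.vret l σ v').erase Lo := by
          rw [Tm.erase, Tm.erase, hu]
        refine .inl ⟨hv, ?_, fun hF => ?_⟩
        · rw [visibleTrace_append, visibleTrace_append, ht, visibleTrace_singleton,
            visibleTrace_singleton, Event.visible_val_congr hv]
        · by_cases hl : l ∈ Lo
          · rw [Tm.erase_vret_mem hl]
            exact hd hF
          · rw [Tm.erase_vret_not_mem hl]
            trivial
      · exact .inr (h.append _ _)
    | vret => simp only [Tm.erase] at he; split at he <;> cases he
    | _ => simp only [Tm.erase, reduceCtorEq] at he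
  | @bind l _ _ _ v _ _ _ hb₁ hb₂ ih₁ ih₂ =>
    cases e' with
    | bind e₁' e₂' =>
      rw [Tm.erase, Tm.erase, Tm.bind.injEq] at he
      obtain ⟨he, he'⟩ := he
      cases hb' with | @bind l' _ _ _ v' _ _ _ hb₁' hb₂' => ?_
      cases h with | bindM h hp k => ?_
      cases h' with | bindM h' hp' k' => ?_
      cases h.unique h' he
      rcases ih₁ hb₁' h h' he fun hF => (hd hF).1 with ⟨hu, ht, hd'⟩ | h
      · refine .prepend ht (.cons_bullet ?_)
        cases (hb₁.preservation hLo h).1 with | vunitM hv kv => ?_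
        cases (hb₁'.preservation hLo h').1 with | vunitM hv' kv' => ?_
        have k := k.inst hv kv
        have k' := k'.inst hv' kv'
        by_cases hl : l ∈ Lo
        · rw [Tm.erase_vret_mem hl, Tm.erase_vret_mem hl, Tm.vret.injEq] at hu
          rw [Tm.erase_vret_mem hl] at hd'
          refine ih₂ hb₂' k k' ?_ fun hF => ?_
          · rw [Tm.erase_inst, Tm.erase_inst, he', hu.2.2]
          · rw [Tm.erase_inst]
            exact Tm.DeclFree.inst (hd hF).2 (hd' hF)
        -- The hidden contents may differ, so the two continuations are unrelated. Both run at the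
        -- hidden label `pc ⊔ l`, hence silently, and their result type protects `l`, hence the
        -- results look alike.
        · have hpc := hLo _ _ (Label.flowsTo_join_right pc l) hl
          obtain ⟨p, hs⟩ := hb₂.preservation hLo k
          obtain ⟨p', hs'⟩ := hb₂'.preservation hLo k'
          obtain ⟨hu, hd⟩ := hp.erase_eq hLo hl hb₂.isValue hb₂'.isValue p p'
          exact .inl ⟨hu, by rw [hs hpc, hs' hpc], fun _ => hd⟩
      · exact .inr (h.append _ _)
    | vret => simp only [Tm.erase] at he; split at he <;> cases he
    | _ => simp only [Tm.erase, reduceCtorEq] at he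
  | decl hb ih =>
    -- The erasure is still a `decl` term, whose `DeclFree` is `False`.
    have hF : ¬ F := hd
    cases e' with
    | decl e' l =>
      rw [Tm.erase, Tm.erase, Tm.decl.injEq] at he
      obtain ⟨he, rfl⟩ := he
      cases hb' with | decl hb' => ?_
      cases h with | decl h hi _ _ => ?_
      cases h' with | decl h' _ _ _ => ?_
      cases h.unique h' he
      rcases ih hb' h h' he fun hf => absurd hf hF with ⟨hu, ht, hd⟩ | hdiv
      · cases (hb.preservation hLo h).1
        cases (hb'.preservation hLo h').1
        exact .down _ (hdecl hF _ _ hi) (fun hf => absurd hf hF) hu ht hd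
      · exact .inr (hdiv.append _ _)
    | vret => simp only [Tm.erase] at he; split at he <;> cases he
    | _ => simp only [Tm.erase, reduceCtorEq] at he
  | endorse hb ih =>
    cases e' with
    | endorse e' l =>
      rw [Tm.erase, Tm.erase, Tm.endorse.injEq] at he
      obtain ⟨he, rfl⟩ := he
      cases hb' with | endorse hb' => ?_
      cases h with | endorse h hc _ hf => ?_
      cases h' with | endorse h' _ _ _ => ?_
      cases h.unique h' he
      rcases ih hb' h h' he hd with ⟨hu, ht, hd⟩ | hdiv
      · cases (hb.preservation hLo h).1
        cases (hb'.preservation hLo h').1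
        exact .down _ (fun h₁ h₂ => (hend _ _ _ hc hf h₁ h₂).2)
          (fun hF h₁ h₂ => (hend _ _ _ hc hf h₁ h₂).1 hF) hu ht hd
      · exact .inr (hdiv.append _ _)
    | vret => simp only [Tm.erase] at he; split at he <;> cases he
    | _ => simp only [Tm.erase, reduceCtorEq] at he

/-! ## Transparent endorsement -/

/-- If one prefix were strictly longer, it would contain the entry at which the other ends. The
filter keeps that entry, so the filtered prefixes would have different lengths. -/
theorem split_filterMap_unique {α β : Type*} {f : α → Option β} {x x' y y' : List α}
    {d d' : α} (h : x ++ d :: y = x' ++ d' :: y') (hd : f d ≠ none) (hd' : f d' ≠ none)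
    (hx : x.filterMap f = x'.filterMap f) : x = x' ∧ d = d' := by
  rw [List.append_eq_append_iff] at h
  have key : ∀ (c : α) (s : List α), f c ≠ none → (c :: s).filterMap f ≠ [] := by
    intro c s hc
    obtain ⟨b, hb⟩ := Option.ne_none_iff_exists'.1 hc
    simp [hb]
  rcases h with ⟨s, rfl, hs⟩ | ⟨s, rfl, hs⟩
  · cases s with
    | nil => simp_all
    | cons c s =>
      cases hs
      rw [List.filterMap_append, List.self_eq_append_right] at hx
      exact absurd hx (key d s hd)
  · cases s with
    | nil => simp_all
    | cons c s =>
      cases hs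
      rw [List.filterMap_append, eq_comm, List.self_eq_append_right] at hx
      exact absurd hx (key d' s hd')

/-- A visible event of a trace can be located in any trace with the same visible part. -/
theorem exists_split_of_visibleTrace_eq {Lo : Set (Label D)} {t a b : Trace D} {c : Event D}
    (hc : c.visible Lo ≠ none) (h : visibleTrace Lo t = visibleTrace Lo (a ++ c :: b)) :
    ∃ a' c' b', t = a' ++ c' :: b' ∧ visibleTrace Lo a' = visibleTrace Lo a ∧
      c'.visible Lo = c.visible Lo := by
  obtain ⟨d, hd⟩ := Option.ne_none_iff_exists'.1 hc
  rw [visibleTrace_append, show visibleTrace Lo (c :: b) = d :: visibleTrace Lo b by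
    simp [visibleTrace, hd], visibleTrace, List.filterMap_eq_append_iff] at h
  obtain ⟨a₁, r, rfl, ha, hr⟩ := h
  rw [List.filterMap_eq_cons_iff] at hr
  obtain ⟨a₂, c', b', rfl, hn, hc', -⟩ := hr
  refine ⟨a₁ ++ a₂, c', b', by simp, ?_, hc'.trans hd.symm⟩
  rw [visibleTrace_append, ← ha]
  have : visibleTrace Lo a₂ = [] := List.filterMap_eq_nil_iff.2 hn
  rw [this, List.append_nil]
  rfl

theorem visibleTrace_take_split {Lo : Set (Label D)} (a b : Trace D) (c : Event D) :
    visibleTrace Lo ((a ++ c :: b).take (a.length + 1)) =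
      visibleTrace Lo a ++ (c.visible Lo).toList := by
  rw [List.take_append, List.take_of_length_le (by simp)]
  simp [visibleTrace_append, visibleTrace_singleton]

/-- Runs with different secrets look the same to the public. -/
theorem Runs.public_agree {A : Set (Label D)} (hA : IsAttacker A) {n : ℕ} {Γ : List (Ty D)}
    {pc : Label D} {τx τy τ : Ty D} {e v v' w : Tm D} {t t' : Trace D}
    (he : HasType n (τy :: τx :: Γ) pc e τ) (hd : e.DeclFree) (hx : HighType (secret A) τx)
    (hv : IsInput n Γ pc τx v) (hv' : IsInput n Γ pc τx v') (hw : IsInput n Γ pc τy w)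
    (hwd : w.DeclFree) (hr : Runs e v w t) (hr' : Runs e v' w t') :
    visibleTrace (secret A)ᶜ t = visibleTrace (secret A)ᶜ t' := by
  obtain ⟨u, s, rfl, hb⟩ := hr.big
  obtain ⟨u', s', rfl, hb'⟩ := hr'.big
  obtain ⟨h, hh, hp⟩ := hx
  have hLo := flowClosed_public hA
  obtain ⟨hvv, hvd⟩ := hp.erase_eq hLo (Set.notMem_compl_iff.2 hh) hv.1 hv'.1 hv.2 hv'.2
  have key := Big.simulation (F := True) (Q := ∅) hLo (fun h => absurd trivial h)
    -- Endorsement keeps confidentiality, so it never leads from secret to public.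
    (fun l' l pc hc _ h₁ h₂ => by
      rw [Set.notMem_compl_iff, secret, Set.mem_ofPred_eq, hc] at h₁
      exact absurd h₁ h₂)
    hb hb' (he.inst₂ hv.1 hv.2 hw.1 hw.2) (he.inst₂ hv'.1 hv'.2 hw.1 hw.2)
    (by rw [Tm.erase_inst₂, Tm.erase_inst₂, hvv])
    (fun _ => by
      rw [Tm.erase_inst₂]
      refine (hd.erase _).subst fun k => ?_
      match k with
      | 0 => exact hwd.erase _
      | 1 => exact hvd
      | _ + 2 => trivial)
  rcases key with ⟨-, ht, -⟩ | ⟨_, _, _, _, _, _, _, _, _, _, _, _, _, _, hQ, _⟩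
  · have := visibleTrace_append (secret A)ᶜ [.val v, .val w] s
    have := visibleTrace_append (secret A)ᶜ [.val v', .val w] s'
    simp_all [visibleTrace, List.filterMap_cons, Event.visible_val_congr hvv]
  -- With `Q` empty no divergence is possible.
  · exact absurd hQ (Set.notMem_empty _)

/-- Runs with different attacks look the same to the trusted, up to an endorsement of public
data. -/
theorem Runs.trusted_agree {A : Set (Label D)} (hA : IsAttacker A) {n : ℕ} {Γ : List (Ty D)}
    {pc : Label D} {τx τy τ : Ty D} {e v w w' : Tm D} {t t' : Trace D}
    (he : HasType n (τy :: τx :: Γ) pc e τ) (hy : HighType (untrusted A) τy)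
    (hv : IsInput n Γ pc τx v) (hw : IsInput n Γ pc τy w) (hw' : IsInput n Γ pc τy w')
    (hr : Runs e v w t) (hr' : Runs e v w' t') :
    visibleTrace (trusted A) t = visibleTrace (trusted A) t' ∨
      Diverge (trusted A) (lowSet A) t t' := by
  obtain ⟨u, s, rfl, hb⟩ := hr.big
  obtain ⟨u', s', rfl, hb'⟩ := hr'.big
  obtain ⟨h, hh, hp⟩ := hy
  have hLo := flowClosed_trusted hA
  obtain ⟨hww, -⟩ := hp.erase_eq hLo (Set.notMem_compl_iff.2 hh) hw.1 hw'.1 hw.2 hw'.2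
  have key := Big.simulation (F := False) (Q := lowSet A) hLo
    -- Declassification keeps integrity, so it never leads from untrusted to trusted.
    (fun _ l' l hi h₁ h₂ => by
      rw [trusted, Set.notMem_compl_iff, untrusted, Set.mem_ofPred_eq, hi] at h₁
      exact absurd h₁ h₂)
    (fun l' l pc hc hf h₁ h₂ => ⟨not_false, public_of_endorse hA hc hf h₁ h₂⟩)
    hb hb' (he.inst₂ hv.1 hv.2 hw.1 hw.2) (he.inst₂ hv.1 hv.2 hw'.1 hw'.2)
    (by rw [Tm.erase_inst₂, Tm.erase_inst₂, hww]) False.elim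
  have h₀ : visibleTrace (trusted A) [.val v, .val w] =
      visibleTrace (trusted A) [.val v, .val w'] := by
    simp [visibleTrace, List.filterMap_cons, Event.visible_val_congr hww]
  rcases key.prepend h₀ with ⟨-, ht, -⟩ | hdiv
  · exact .inl ht
  · exact .inr hdiv

theorem visibleTrace_eq_of_subset {Lo Lo' : Set (Label D)} (h : Lo' ⊆ Lo) {s t : Trace D}
    (hst : visibleTrace Lo s = visibleTrace Lo t) :
    visibleTrace Lo' s = visibleTrace Lo' t := by
  rw [← visibleTrace_visibleTrace h s, hst, visibleTrace_visibleTrace h t]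

theorem Event.visible_ne_none_of_subset {Lo Lo' : Set (Label D)} (h : Lo' ⊆ Lo) {c : Event D}
    {d : Event D} (hc : c.visible Lo = some d) (hd : c.visible Lo' ≠ none) :
    d.visible Lo' ≠ none := by
  rw [← Event.visible_bind_visible h c, hc] at hd
  exact hd

/-- In traces that look the same at `Lo`, prefixes ending in an event visible at `Lo'` that look
the same at `Lo'` also look the same at `Lo`. -/
theorem visible_prefix_eq {Lo Lo' : Set (Label D)} (h : Lo' ⊆ Lo) {a b a' b' : Trace D}
    {c c' : Event D}
    (ht : visibleTrace Lo (a ++ c :: b) = visibleTrace Lo (a' ++ c' :: b'))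
    (hc : c.visible Lo' ≠ none) (hc' : c'.visible Lo' ≠ none)
    (ha : visibleTrace Lo' a = visibleTrace Lo' a') :
    visibleTrace Lo a = visibleTrace Lo a' ∧ c.visible Lo = c'.visible Lo := by
  have some_of : ∀ c : Event D, c.visible Lo' ≠ none → ∃ d, c.visible Lo = some d := by
    intro c hc
    rw [← Option.ne_none_iff_exists']
    intro hn
    rw [← Event.visible_bind_visible h c, hn] at hc
    exact hc rfl
  obtain ⟨d, hd⟩ := some_of c hc
  obtain ⟨d', hd'⟩ := some_of c' hc'
  rw [visibleTrace_append, visibleTrace_append] at ht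
  have cons : ∀ {c d : Event D} (b : Trace D), c.visible Lo = some d →
      visibleTrace Lo (c :: b) = d :: visibleTrace Lo b := fun b hd => by
    simp [visibleTrace, hd]
  rw [cons b hd, cons b' hd'] at ht
  rw [← visibleTrace_visibleTrace h a, ← visibleTrace_visibleTrace h a'] at ha
  -- Both cuts of the common `Lo`-visible trace end in an entry visible at `Lo'`, so counting the
  -- `Lo'`-visible entries before them shows that they are the same cut.
  obtain ⟨h₁, h₂⟩ := split_filterMap_unique ht
    (Event.visible_ne_none_of_subset h hd hc) (Event.visible_ne_none_of_subset h hd' hc') ha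
  exact ⟨h₁, by rw [hd, hd', h₂]⟩

end NMIFC

/-! ### The irrelevance witness and the conclusion. -/

open NMIFC in
theorem mainTheorem3 {N : Type*} (D : NMIFC.Delegation N)
    (n : ℕ) (Γ : List (NMIFC.Ty D)) (pc : NMIFC.Label D) (τx τy τ : NMIFC.Ty D)
    (e : NMIFC.Tm D) (he : NMIFC.HasType n (τy :: τx :: Γ) pc e τ) (hd : e.DeclFree) :
    NMIFC.TransparentlyEndorses n Γ pc τx τy e := by
  intro A hA hx hy v w t hv hw hr ⟨hrel, h₀⟩
  rw [traceEquiv_iff_visibleTrace_eq] at h₀ ⊢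
  rcases Runs.trusted_agree hA he hy (hv 1) (hw 0).1 (hw 1).1 (hr 1 0) (hr 1 1) with h₁ | hdiv
  · exact h₁
  refine absurd ?_ hrel
  obtain ⟨a, b, a', b', π, l', l, σ, x, x', hs, hs', ha, hlT, hlQ, hne⟩ := hdiv
  have hT : lowSet A ⊆ trusted A := Set.inter_subset_left
  have hP : lowSet A ⊆ (secret A)ᶜ := Set.inter_subset_right
  have hpub : ∀ j, visibleTrace (lowSet A) (t 0 j) = visibleTrace (lowSet A) (t 1 j) := fun j =>
    visibleTrace_eq_of_subset hP
      (Runs.public_agree hA he hd hx (hv 0) (hv 1) (hw j).1 (hw j).2 (hr 0 j) (hr 1 j))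
  have hlow := visibleTrace_eq_of_subset hT h₀
  set c : Event D := .down π l' l σ x with hcdef
  set c' : Event D := .down π l' l σ x' with hcdef'
  have hc : c.visible (lowSet A) ≠ none := by simp [hcdef, Event.visible_down_mem hlQ]
  have hc' : c'.visible (lowSet A) ≠ none := by simp [hcdef', Event.visible_down_mem hlQ]
  -- The divergent endorsement targets a public trusted label, so public agreement yields a matching
  -- event in each trace of the first secret.
  obtain ⟨a₀, c₀, b₀, hs₀, ha₀, hc₀⟩ := exists_split_of_visibleTrace_eq hc (hs ▸ hpub 0)
  obtain ⟨a₁, c₁, b₁, hs₁, ha₁, hc₁⟩ := exists_split_of_visibleTrace_eq hc' (hs' ▸ hpub 1)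
  have haa := visibleTrace_eq_of_subset hT ha
  -- The second-secret traces are compared by way of the first secret: change the secret, then the
  -- attack using `h₀`, then the secret back.
  have h10 : visibleTrace (lowSet A) (a ++ c :: b) = visibleTrace (lowSet A) (a' ++ c' :: b') := by
    rw [← hs, ← hs', ← hpub 0, ← hpub 1, hlow]
  have hcc : c.visible (lowSet A) = c'.visible (lowSet A) :=
    (visible_prefix_eq subset_rfl h10 hc hc' haa).2
  -- Positions count from zero, so the length of the part before the chosen event is its index.
  refine ⟨hv 0, v, w, t, ![![a₀.length, a₁.length], ![a.length, a'.length]], rfl, hv 1,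
    fun j => (hw j).1, hr, ?_, ?_, ?_, ?_⟩
  · simp only [eventEquiv_iff_visible_eq]
    intro i j
    fin_cases i <;> fin_cases j
    · exact ⟨c₀, by simp [hs₀], hc₀ ▸ hc⟩
    · exact ⟨c₁, by simp [hs₁], hc₁ ▸ hc'⟩
    · exact ⟨c, by simp [hs], hc⟩
    · exact ⟨c', by simp [hs'], hc'⟩
  · have key : ∀ i j, visibleTrace (lowSet A) ((t i j).take
        ((![![a₀.length, a₁.length], ![a.length, a'.length]] : Fin 2 → Fin 2 → ℕ) i j + 1)) =
        visibleTrace (lowSet A) a ++ (c.visible (lowSet A)).toList := by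
      intro i j
      fin_cases i <;> fin_cases j
      · simp [hs₀, visibleTrace_take_split, ha₀, hc₀]
      · simp [hs₁, visibleTrace_take_split, ha₁, hc₁, haa, hcc]
      · simp [hs, visibleTrace_take_split]
      · simp [hs', visibleTrace_take_split, haa, hcc]
    intro i j i' j'
    rw [traceEquiv_iff_visibleTrace_eq, key, key]
  -- The first-secret traces are equal for trusted observers, and low equality of the cuts
  -- identifies their positions, so the prefixes are equal as well.
  · have := visible_prefix_eq hT (hs₀ ▸ hs₁ ▸ h₀) (hc₀ ▸ hc) (hc₁ ▸ hc')
      (by rw [ha₀, ha₁, haa])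
    rw [traceEquiv_iff_visibleTrace_eq]
    simp [hs₀, hs₁, visibleTrace_take_split, this.1, this.2]
  · rw [traceEquiv_iff_visibleTrace_eq]
    intro h
    -- The trusted parts before the endorsements cancel, leaving equality of the two erased
    -- payloads.
    simp [hs, hs', visibleTrace_take_split, ha, hcdef, hcdef', Event.visible_down_mem hlT] at h
    exact hne h
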